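/- Let $(M,g)$ be a smooth 4-dimensional manifold with a smooth Lorentzian metric of signature $(-1,1,1,1)$ and Levi-Civita derivative $\nabla$. Let $\mathcal F$ be a null foliation of $M$, i.e. a smooth foliation by 2-dimensional leaves on whose tangent planes $T\mathcal F$ the metric $g$ is degenerate. Let $(U,\varphi=(x^1,\dots,x^4))$ be an adapted chart centered at a point $p\in M$: a smooth chart with $\varphi(p)=0$ in which the slices of constant $(x^3,x^4)$ are exactly the (connected) leaves of $\mathcal F|_U$. Let $(s,l,\alpha^\sharp,n)$ be an adapted frame on $U$: smooth vector fields such that $s,l$ span $T\mathcal F$, $g(s,s)=g(\alpha^\sharp,\alpha^\sharp)=1$, $g(l,l)=g(n,n)=0$, $g(n,l)=-1$, and all other products vanish; put $\alpha=g(\alpha^\sharp,\cdot)$ and $l^\flat=g(l,\cdot)$. Write $\alpha=\alpha_3dx^3+\alpha_4dx^4$, $l^\flat=l^\flat_3dx^3+l^\flat_4dx^4$ and $\kappa=(\alpha_3l^\flat_4-\alpha_4l^\flat_3)^{-1}$. For a smooth function $u=u(x^3,x^4)$ on the leaf space of $\mathcal F|_U$ put $$F_u=(u\,\kappa)\;\alpha\wedge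 l^\flat .$$ A smooth 2-form $F$ on $U$ is a null force-free field if $dF=0$, $i_{j^\sharp}F=0$ for $j=*\,d*F$, and $F_{\mu\nu}F^{\mu\nu}=0$; its kernel at $x$ is $\{v\in T_xM : i_vF=0\}$. The field $l$ is pregeodesic if $\nabla_l l=f\,l$ for some function $f$ on $U$. The null mean curvature (expansion) is $\theta=\tfrac12\,[\,g(\nabla_s l,s)+g(\nabla_{\alpha^\sharp}l,\alpha^\sharp)\,]$, and $\mathcal F$ admits an equipartition of null mean curvature with respect to $l$ if $\theta=g(\nabla_s l,s)$ on $U$ (equivalently, $\theta=g(\nabla_s l,s)=g(\nabla_{\alpha^\sharp}l,\alpha^\sharp)$). Theorem. (1) The following are equivalent. (a) The forms $F_u$ are the unique class of null force-free solutions on $U$ whose kernel is exactly $T\mathcal F$. That is: for every smooth function $u$ on the leaf space of $\mathcal F|_U$, $F_u$ is a null force-free field on $U$, with kernel exactly $T\mathcal F$ at each point where $u\neq0$; and every null force-free field on $U$ whose kernel is exactly $T\mathcal F$ at each point of $U$ equals $F_u$ for some nowhere vanishing smooth function $u$ on the leaf space. (b) $l$ is pregeodesic on $U$, and $\mathcal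 F$ admits an equipartition of null mean curvature with respect to $l$ on $U$. (2) Moreover, for each single nowhere vanishing smooth function $u$ on the leaf space, $F_u$ is a null force-free field on $U$ with kernel exactly $T\mathcal F$ if and only if (b) holds. (3) The conditions in (b) do not depend on the choice of $s$: if $\tilde s$ is any smooth field on $U$ with values in $T\mathcal F$ and $g(\tilde s,\tilde s)=1$, then $g(\nabla_{\tilde s}l,\tilde s)=g(\nabla_s l,s)$ on $U$, and the equipartition condition for $\tilde s$ (with the same $l$ and $\alpha$) is equivalent to that for $s$. -/

import Mathlib

open scoped Manifold ContDiff Topology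
open Bundle

noncomputable section

/-- The model space of spacetime: `ℝ⁴`. The coordinates `x¹, x², x³, x⁴` are the
components with indices `0, 1, 2, 3`. -/
abbrev E4 : Type := EuclideanSpace ℝ (Fin 4)

/-- The standard basis vector `∂_a` of `ℝ⁴`. -/
def stdVec (a : Fin 4) : E4 := EuclideanSpace.single a (1 : ℝ)

/-! ### Multilinear algebra -/

/-- The wedge product of two covectors: `(α ∧ β)(v, w) = α(v) β(w) - α(w) β(v)`. -/
def wedge₁ {V : Type*} [AddCommGroup V] [Module ℝ V] [TopologicalSpace V]
    (α β : V →L[ℝ] ℝ) : V [⋀^Fin 2]→L[ℝ] ℝ where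
  toFun v := α (v 0) * β (v 1) - α (v 1) * β (v 0)
  map_update_add' {inst} v i x y := by
    cases Subsingleton.elim inst (instDecidableEqFin 2)
    fin_cases i <;> simp <;> ring
  map_update_smul' {inst} v i c x := by
    cases Subsingleton.elim inst (instDecidableEqFin 2)
    fin_cases i <;> simp <;> ring
  map_eq_zero_of_eq' v i j h hij := by
    fin_cases i <;> fin_cases j <;> simp_all
  cont := by fun_prop

/-- The index raising map `ξ ↦ ξ♯` of a bilinear form `B`, the inverse of `v ↦ B(v, ·)`. -/
def sharpB {V : Type*} [AddCommGroup V] [Module ℝ V] [TopologicalSpace V]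
    [IsTopologicalAddGroup V] [ContinuousSMul ℝ V]
    (B : V →L[ℝ] V →L[ℝ] ℝ) (ξ : V →L[ℝ] ℝ) : V :=
  ContinuousLinearMap.inverse B ξ

/-- The standard determinant form `dx¹ ∧ dx² ∧ dx³ ∧ dx⁴` on `ℝ⁴`. -/
def detForm : E4 [⋀^Fin 4]→L[ℝ] ℝ where
  toMultilinearMap := ((Matrix.detRowAlternating (n := Fin 4) (R := ℝ)).compLinearMap
    (EuclideanSpace.equiv (Fin 4) ℝ).toLinearMap).toMultilinearMap
  map_eq_zero_of_eq' v i j h hij := by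
    exact ((Matrix.detRowAlternating (n := Fin 4) (R := ℝ)).compLinearMap
      (EuclideanSpace.equiv (Fin 4) ℝ).toLinearMap).map_eq_zero_of_eq v h hij
  cont := by
    change Continuous fun v : Fin 4 → E4 => Matrix.det (fun i j => v i j)
    exact Continuous.matrix_det (by fun_prop)

/-- The metric volume form `√|det B_{ab}| dx¹ ∧ dx² ∧ dx³ ∧ dx⁴` of a bilinear form on `ℝ⁴`. -/
def volForm (B : E4 →L[ℝ] E4 →L[ℝ] ℝ) : E4 [⋀^Fin 4]→L[ℝ] ℝ :=
  Real.sqrt |Matrix.det (Matrix.of fun a b => B (stdVec a) (stdVec b))| • detForm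

/-- The raised coordinate covector `(dx^a)♯ = g^{ab} ∂_b`. -/
def raised (B : E4 →L[ℝ] E4 →L[ℝ] ℝ) (a : Fin 4) : E4 :=
  sharpB B (EuclideanSpace.proj a : E4 →L[ℝ] ℝ)

/-- Hodge star on 2-forms: `(*η)_{cd} = (1/2) η^{ab} ε_{abcd}`. -/
def hodgeStar₂ (B : E4 →L[ℝ] E4 →L[ℝ] ℝ) (η : E4 [⋀^Fin 2]→L[ℝ] ℝ) : E4 [⋀^Fin 2]→L[ℝ] ℝ :=
  (1 / 2 : ℝ) • ∑ a, ∑ b, η ![raised B a, raised B b] •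
    ((volForm B).curryLeft (stdVec a)).curryLeft (stdVec b)

/-- Hodge star on 3-forms: `(*η)_{d} = (1/6) η^{abc} ε_{abcd}`. -/
def hodgeStar₃ (B : E4 →L[ℝ] E4 →L[ℝ] ℝ) (η : E4 [⋀^Fin 3]→L[ℝ] ℝ) : E4 [⋀^Fin 1]→L[ℝ] ℝ :=
  (1 / 6 : ℝ) • ∑ a, ∑ b, ∑ c, η ![raised B a, raised B b, raised B c] •
    (((volForm B).curryLeft (stdVec a)).curryLeft (stdVec b)).curryLeft (stdVec c)

/-- The square `η_{ab} η^{ab}` of a 2-form. -/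
def formSq (B : E4 →L[ℝ] E4 →L[ℝ] ℝ) (η : E4 [⋀^Fin 2]→L[ℝ] ℝ) : ℝ :=
  ∑ a, ∑ b, η ![stdVec a, stdVec b] * η ![raised B a, raised B b]

/-! ### Lorentzian geometry on a 4-manifold

The exterior derivative, the Levi-Civita derivative and the current at a point `x` are computed by
their usual coordinate formulas in the preferred chart at `x`. -/

section Spacetime

variable {M : Type*} [TopologicalSpace M] [ChartedSpace E4 M] [IsManifold (𝓡 4) ∞ M]

/-- A smooth Lorentzian metric of signature `(-1, 1, 1, 1)`. -/
structure LorentzMetric (M : Type*) [TopologicalSpace M] [ChartedSpace E4 M]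
    [IsManifold (𝓡 4) ∞ M] where
  val (x : M) : TangentSpace (𝓡 4) x →L[ℝ] TangentSpace (𝓡 4) x →L[ℝ] ℝ
  symm (x : M) (v w : TangentSpace (𝓡 4) x) : val x v w = val x w v
  signature (x : M) : ∃ b : Module.Basis (Fin 4) ℝ (TangentSpace (𝓡 4) x),
    ∀ i j, val x (b i) (b j) = if i = j then (if i = 0 then -1 else 1) else 0
  contMDiff : ContMDiff (𝓡 4) ((𝓡 4).prod 𝓘(ℝ, E4 →L[ℝ] E4 →L[ℝ] ℝ)) ∞
    (fun x : M => TotalSpace.mk' (E4 →L[ℝ] E4 →L[ℝ] ℝ)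
      (E := fun x : M => TangentSpace (𝓡 4) x →L[ℝ] TangentSpace (𝓡 4) x →L[ℝ] ℝ) x (val x))

variable (M) in
/-- A (not necessarily continuous) vector field. -/
abbrev VField : Type _ := (x : M) → TangentSpace (𝓡 4) x

variable (M) in
/-- A (not necessarily continuous) differential `k`-form. -/
abbrev DForm (k : ℕ) : Type _ := (x : M) → TangentSpace (𝓡 4) x [⋀^Fin k]→L[ℝ] ℝ

/-- Smoothness of a vector field on a set. -/
def SmoothVFieldOn (X : VField M) (U : Set M) : Prop :=
  ContMDiffOn (𝓡 4) (𝓡 4).tangent ∞ (fun x => (TotalSpace.mk' E4 x (X x) : TangentBundle (𝓡 4) M)) U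

/-- `chartPush x y : ℝ⁴ → T M` is the derivative at `y` of the inverse of the preferred chart
at `x`; it sends the standard basis vectors to the coordinate vector fields. -/
def chartPush (x : M) (y : E4) : E4 →L[ℝ] TangentSpace (𝓡 4) ((extChartAt (𝓡 4) x).symm y) :=
  mfderiv 𝓘(ℝ, E4) (𝓡 4) (extChartAt (𝓡 4) x).symm y

/-- The derivative at `x` of the preferred chart at `x`. -/
def chartDeriv (x : M) : TangentSpace (𝓡 4) x →L[ℝ] E4 :=
  mfderiv (𝓡 4) 𝓘(ℝ, E4) (extChartAt (𝓡 4) x) x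

/-- The coordinate expression of a form in the preferred chart at `x`. -/
def formInChart {k : ℕ} (η : DForm M k) (x : M) (y : E4) : E4 [⋀^Fin k]→L[ℝ] ℝ :=
  (η ((extChartAt (𝓡 4) x).symm y)).compContinuousLinearMap (chartPush x y)

/-- The coordinate expression of a vector field in the preferred chart at `x`. -/
def vfieldInChart (X : VField M) (x : M) : E4 → E4 :=
  VectorField.mpullback 𝓘(ℝ, E4) (𝓡 4) (extChartAt (𝓡 4) x).symm X

/-- The coordinate expression of the metric in the preferred chart at `x`. -/
def LorentzMetric.inChart (g : LorentzMetric M) (x : M) (y : E4) : E4 →L[ℝ] E4 →L[ℝ] ℝ :=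
  ContinuousLinearMap.bilinearComp (E := E4) (F := E4) (g.val ((extChartAt (𝓡 4) x).symm y))
    (chartPush x y) (chartPush x y)

/-- Smoothness of a form on an open set. -/
def SmoothFormOn {k : ℕ} (η : DForm M k) (U : Set M) : Prop :=
  ∀ x ∈ U, ContDiffAt ℝ ∞ (formInChart η x) (extChartAt (𝓡 4) x x)

/-- The exterior derivative. -/
def extD {k : ℕ} (η : DForm M k) : DForm M (k + 1) := fun x =>
  (extDeriv (formInChart η x) (extChartAt (𝓡 4) x x)).compContinuousLinearMap (chartDeriv x)

/-- Lowering an index: `X♭ = g(X, ·)`. -/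
def LorentzMetric.flat (g : LorentzMetric M) (X : VField M) (x : M) :
    TangentSpace (𝓡 4) x →L[ℝ] ℝ := g.val x (X x)

/-- The Christoffel symbols of the first kind of a metric `G` on `ℝ⁴`, as the covector
`z ↦ (1/2) (∂_v G(w, z) + ∂_w G(v, z) - ∂_z G(v, w))`. -/
def christoffelLower (G : E4 → E4 →L[ℝ] E4 →L[ℝ] ℝ) (y v w : E4) : E4 →L[ℝ] ℝ :=
  (1 / 2 : ℝ) • (fderiv ℝ G y v w + fderiv ℝ G y w v - ((fderiv ℝ G y).flip v).flip w)

/-- The Levi-Civita covariant derivative `∇_v Y` at `x`: in coordinates,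
`(∇_v Y)^c = v^a ∂_a Y^c + Γ^c_{ab} v^a Y^b`. -/
def LorentzMetric.nabla (g : LorentzMetric M) (Y : VField M) (x : M)
    (v : TangentSpace (𝓡 4) x) : TangentSpace (𝓡 4) x :=
  (chartDeriv x).inverse
    (fderiv ℝ (vfieldInChart Y x) (extChartAt (𝓡 4) x x) (chartDeriv x v) +
      sharpB (g.inChart x (extChartAt (𝓡 4) x x))
        (christoffelLower (g.inChart x) (extChartAt (𝓡 4) x x) (chartDeriv x v)
          (vfieldInChart Y x (extChartAt (𝓡 4) x x))))

/-- The current density 1-form `j = * d * F`. It does not depend on an orientation, as the Hodge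
star enters twice; near `x` the orientation of the preferred chart at `x` is used. -/
def LorentzMetric.current (g : LorentzMetric M) (F : DForm M 2) : DForm M 1 := fun x =>
  (hodgeStar₃ (g.inChart x (extChartAt (𝓡 4) x x))
    (extDeriv (fun y => hodgeStar₂ (g.inChart x y) (formInChart F x y))
      (extChartAt (𝓡 4) x x))).compContinuousLinearMap (chartDeriv x)

/-- The current density vector `j♯`. -/
def LorentzMetric.currentVec (g : LorentzMetric M) (F : DForm M 2) : VField M := fun x =>
  sharpB (g.val x) ((ContinuousAlternatingMap.ofSubsingleton ℝ (TangentSpace (𝓡 4) x) ℝ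
    (0 : Fin 1)).symm (g.current F x))

/-- The scalar `F² = F_{μν} F^{μν}`. -/
def LorentzMetric.fieldSq (g : LorentzMetric M) (F : DForm M 2) (x : M) : ℝ :=
  formSq (g.inChart x (extChartAt (𝓡 4) x x)) (formInChart F x (extChartAt (𝓡 4) x x))

/-- `F` is a null force-free electromagnetic field on the open set `U`: a smooth 2-form with
`dF = 0`, `i_{j♯} F = 0` for `j = * d * F`, and `F² = 0`. -/
structure IsNullForceFreeOn (g : LorentzMetric M) (F : DForm M 2) (U : Set M) : Prop where
  smooth : SmoothFormOn F U
  closed : ∀ x ∈ U, extD F x = 0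
  forceFree : ∀ x ∈ U, ∀ v : TangentSpace (𝓡 4) x, F x ![g.currentVec F x, v] = 0
  null : ∀ x ∈ U, g.fieldSq F x = 0

/-- The kernel of a 2-form at `x`: all `v` with `i_v F = 0`. -/
def formKer (F : DForm M 2) (x : M) : Set (TangentSpace (𝓡 4) x) :=
  {v | ∀ w, F x ![v, w] = 0}

/-! ### Null foliations, adapted charts and adapted frames -/

/-- The differential at `x` of the coordinate function `x^a` of a chart. -/
def dcoord (φ : OpenPartialHomeomorph M E4) (a : Fin 4) (x : M) : TangentSpace (𝓡 4) x →L[ℝ] ℝ :=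
  (EuclideanSpace.proj a : E4 →L[ℝ] ℝ) ∘L
    (mfderiv (𝓡 4) 𝓘(ℝ, E4) φ x : TangentSpace (𝓡 4) x →L[ℝ] E4)

/-- The coordinate vector field `∂_a` of a chart. -/
def coordVec (φ : OpenPartialHomeomorph M E4) (a : Fin 4) (x : M) : TangentSpace (𝓡 4) x :=
  (mfderiv (𝓡 4) 𝓘(ℝ, E4) φ x : TangentSpace (𝓡 4) x →L[ℝ] E4).inverse (stdVec a)

/-- The plane field `D` is, on the domain of the chart `φ`, tangent to the slices on which `x³`
and `x⁴` are constant. -/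
def TangentToSlices (D : (x : M) → Submodule ℝ (TangentSpace (𝓡 4) x))
    (φ : OpenPartialHomeomorph M E4) : Prop :=
  ∀ x ∈ φ.source, ∀ v, v ∈ D x ↔ dcoord φ 2 x v = 0 ∧ dcoord φ 3 x v = 0

/-- A null foliation: a foliation of `M` by 2-dimensional leaves on which `g` is degenerate. The
foliation is given by its field of tangent planes `T(𝓕)`, which around each point is tangent to the
slices of a smooth chart; the leaves are its maximal connected integral surfaces. -/
structure NullFoliation (g : LorentzMetric M) where
  tangent (x : M) : Submodule ℝ (TangentSpace (𝓡 4) x)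
  exists_chart (p : M) : ∃ φ ∈ IsManifold.maximalAtlas (𝓡 4) ∞ M,
    p ∈ φ.source ∧ TangentToSlices tangent φ
  degenerate (x : M) : ∃ v ∈ tangent x, v ≠ 0 ∧ ∀ w ∈ tangent x, g.val x v w = 0

/-- A null foliation adapted chart centered at `p`: a smooth chart in which the slices of
constant `x³` and `x⁴` are exactly the leaves of the foliation restricted to the chart domain
(so each slice is tangent to the foliation and connected). -/
structure IsAdaptedChart {g : LorentzMetric M} (𝓕 : NullFoliation g) (p : M)
    (φ : OpenPartialHomeomorph M E4) : Prop where
  mem_atlas : φ ∈ IsManifold.maximalAtlas (𝓡 4) ∞ M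
  mem_source : p ∈ φ.source
  centered : φ p = 0
  tangent : TangentToSlices 𝓕.tangent φ
  connected : ∀ c d : ℝ, IsPreconnected {y : E4 | y ∈ φ.target ∧ y 2 = c ∧ y 3 = d}

/-- `(s, l, a, n)` is a null foliation adapted frame on `U`, where `a = α♯`: the fields `s, l` span
the tangent planes of the foliation, `l` and `n` are null with `g(n, l) = -1`, `s` and `a` are unit
spacelike, and all other products vanish; so `α = a♭` and `l♭` annihilate the foliation. -/
structure IsAdaptedFrame {g : LorentzMetric M} (𝓕 : NullFoliation g) (U : Set M)
    (s l a n : VField M) : Prop where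
  smooth_s : SmoothVFieldOn s U
  smooth_l : SmoothVFieldOn l U
  smooth_a : SmoothVFieldOn a U
  smooth_n : SmoothVFieldOn n U
  span : ∀ x ∈ U, Submodule.span ℝ {s x, l x} = 𝓕.tangent x
  ss : ∀ x ∈ U, g.val x (s x) (s x) = 1
  ll : ∀ x ∈ U, g.val x (l x) (l x) = 0
  aa : ∀ x ∈ U, g.val x (a x) (a x) = 1
  nn : ∀ x ∈ U, g.val x (n x) (n x) = 0
  nl : ∀ x ∈ U, g.val x (n x) (l x) = -1
  ls : ∀ x ∈ U, g.val x (l x) (s x) = 0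
  la : ∀ x ∈ U, g.val x (l x) (a x) = 0
  sa : ∀ x ∈ U, g.val x (s x) (a x) = 0
  ns : ∀ x ∈ U, g.val x (n x) (s x) = 0
  na : ∀ x ∈ U, g.val x (n x) (a x) = 0

/-- The function `κ = (α₃ l♭₄ - α₄ l♭₃)⁻¹`, where `α = a♭`. -/
def kappa (g : LorentzMetric M) (φ : OpenPartialHomeomorph M E4) (l a : VField M) (x : M) : ℝ :=
  (g.flat a x (coordVec φ 2 x) * g.flat l x (coordVec φ 3 x) -
    g.flat a x (coordVec φ 3 x) * g.flat l x (coordVec φ 2 x))⁻¹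

/-- The 2-form `F = (u κ) α ∧ l♭`, where `α = a♭`. -/
def fieldForm (g : LorentzMetric M) (φ : OpenPartialHomeomorph M E4) (l a : VField M)
    (u : M → ℝ) : DForm M 2 := fun x =>
  (u x * kappa g φ l a x) • wedge₁ (g.flat a x) (g.flat l x)

/-- A smooth function `u = u(x³, x⁴)` on the leaf space of the foliation restricted to the domain
of an adapted chart `φ`. -/
def IsLeafFunction (φ : OpenPartialHomeomorph M E4) (u : M → ℝ) : Prop :=
  ContMDiffOn (𝓡 4) 𝓘(ℝ, ℝ) ∞ u φ.source ∧
    ∀ x ∈ φ.source, ∀ y ∈ φ.source, φ x 2 = φ y 2 → φ x 3 = φ y 3 → u x = u y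

/-- The vector field `l` is pregeodesic on `U`: `∇_l l` is a multiple of `l`. -/
def IsPregeodesicOn (g : LorentzMetric M) (l : VField M) (U : Set M) : Prop :=
  ∃ f : M → ℝ, ∀ x ∈ U, g.nabla l x (l x) = f x • l x

/-- The null mean curvature `θ = (1/2) (g(∇_s l, s) + g(∇_a l, a))`. -/
def nullMeanCurvature (g : LorentzMetric M) (s l a : VField M) (x : M) : ℝ :=
  (1 / 2 : ℝ) * (g.val x (g.nabla l x (s x)) (s x) + g.val x (g.nabla l x (a x)) (a x))

/-- Equipartition of null mean curvature with respect to `l`: `θ = g(∇_s l, s)`. -/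
def HasEquipartitionOn (g : LorentzMetric M) (s l a : VField M) (U : Set M) : Prop :=
  ∀ x ∈ U, nullMeanCurvature g s l a x = g.val x (g.nabla l x (s x)) (s x)

/-- The forms `(u κ) α ∧ l♭`, for `u` a smooth function on the leaf space, are the unique class of
null force-free solutions on the chart domain whose kernels are exactly the leaf tangent planes:
each of them is a null force-free field, with that kernel wherever `u ≠ 0`, and each null
force-free field with that kernel is one of them. -/
structure IsUniqueSolutionClass {g : LorentzMetric M} (𝓕 : NullFoliation g)
    (φ : OpenPartialHomeomorph M E4) (l a : VField M) : Prop where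
  solution : ∀ u : M → ℝ, IsLeafFunction φ u →
    IsNullForceFreeOn g (fieldForm g φ l a u) φ.source
  kernel : ∀ u : M → ℝ, IsLeafFunction φ u → ∀ x ∈ φ.source, u x ≠ 0 →
    formKer (fieldForm g φ l a u) x = 𝓕.tangent x
  unique : ∀ F : DForm M 2, IsNullForceFreeOn g F φ.source →
    (∀ x ∈ φ.source, formKer F x = 𝓕.tangent x) →
    ∃ u : M → ℝ, IsLeafFunction φ u ∧ (∀ x ∈ φ.source, u x ≠ 0) ∧
      ∀ x ∈ φ.source, F x = fieldForm g φ l a u x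

end Spacetime

end

/-!
The coefficient `κ` is chosen so that `κ α ∧ l♭ = dx³ ∧ dx⁴`: both `α` and `l♭` annihilate the
leaves (`wedge_flat_eq`, `fieldForm_eq_coordForm`). Hence `F_u = u dx³ ∧ dx⁴` is smooth and closed
for every function `u` on the leaf space, its kernel is the tangent plane of the leaf wherever
`u ≠ 0`, and it is null because `l` is null and orthogonal to `α♯`. Conversely a closed form with
kernel the tangent planes is `u dx³ ∧ dx⁴`, and closedness says that `∂₁u = ∂₂u = 0`; as the slices
are connected, `u` is a function on the leaf space (`isLeafFunction_of_closed`).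

What remains is the force-free condition. In the frame `(s, l, α♯, n)` the dual of
`F = w α ∧ l♭` is `± w s♭ ∧ l♭`, the sign being the locally constant orientation of the frame. The
vector `j♯` lies in the kernel of `F`, spanned by `s` and `l`, exactly when `j(l) = j(α♯) = 0`, and
up to sign these are the components of `d(w s♭ ∧ l♭)` along `(s, l, α♯)` and `(s, l, n)`. For a unit
spacelike `t` orthogonal to `l` and `n`, metric compatibility and symmetry of the Levi-Civita
derivative give
`d(w t♭ ∧ l♭)(t, l, n) = w g(∇_t l, t) + l(w) - w g(∇_l l, n)`.
For `t = α♯` this vanishes since `dF = 0`; subtracting it from the case `t = s` leaves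
`w (g(∇_s l, s) - g(∇_{α♯} l, α♯))`, which vanishes exactly under equipartition. The component along
`(s, l, α♯)` is `- w g(∇_l l, α♯)`. Together with `g(∇_l l, l) = 0`, as `l` is null, and
`g(∇_l l, s) = 0`, which is the component of `dF = 0` along `(α♯, l, s)`, its vanishing says that `l`
is pregeodesic (`IsNullFrameNear.current_iff`, `pregeodesic_and_equipartition_iff`). The same
relations show that `g(∇_t l, t)` is the same for all unit fields `t = ± s + d l`.
-/

noncomputable section

/-! ### Null frames of a Lorentzian inner product -/

/-- `(s, l, a, n)` is a null frame of the symmetric bilinear form `B` on `ℝ⁴`: `s` and `a` are unit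
spacelike, `l` and `n` are null with `B(n, l) = -1`, and the other products vanish. -/
structure IsNullFrame (B : E4 →L[ℝ] E4 →L[ℝ] ℝ) (s l a n : E4) : Prop where
  symm : ∀ v w, B v w = B w v
  ss : B s s = 1
  ll : B l l = 0
  aa : B a a = 1
  nn : B n n = 0
  nl : B n l = -1
  ls : B l s = 0
  la : B l a = 0
  sa : B s a = 0
  ns : B n s = 0
  na : B n a = 0

@[simp] theorem wedge₁_apply {V : Type*} [AddCommGroup V] [Module ℝ V] [TopologicalSpace V]
    (α β : V →L[ℝ] ℝ) (v w : V) : wedge₁ α β ![v, w] = α v * β w - α w * β v := rfl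

theorem sum_coord_smul_stdVec (v : E4) : ∑ i, v i • stdVec i = v := by
  ext j
  simp [stdVec, Pi.single_apply]

theorem sum_coord_mul (ξ : E4 →L[ℝ] ℝ) (v : E4) : ∑ i, v i * ξ (stdVec i) = ξ v := by
  conv_rhs => rw [← sum_coord_smul_stdVec v]
  simp

namespace IsNullFrame

variable {B : E4 →L[ℝ] E4 →L[ℝ] ℝ} {s l a n : E4}

theorem ln (h : IsNullFrame B s l a n) : B l n = -1 := by rw [h.symm, h.nl]
theorem sl (h : IsNullFrame B s l a n) : B s l = 0 := by rw [h.symm, h.ls]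
theorem al (h : IsNullFrame B s l a n) : B a l = 0 := by rw [h.symm, h.la]
theorem as (h : IsNullFrame B s l a n) : B a s = 0 := by rw [h.symm, h.sa]
theorem sn (h : IsNullFrame B s l a n) : B s n = 0 := by rw [h.symm, h.ns]
theorem an (h : IsNullFrame B s l a n) : B a n = 0 := by rw [h.symm, h.na]

/-- Exchanging the two spacelike legs gives a null frame again. -/
theorem swap (h : IsNullFrame B s l a n) : IsNullFrame B a l s n :=
  ⟨h.symm, h.aa, h.ll, h.ss, h.nn, h.nl, h.la, h.ls, h.as, h.na, h.ns⟩

theorem linearIndependent (h : IsNullFrame B s l a n) :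
    LinearIndependent ℝ ![s, l, a, n] := by
  rw [Fintype.linearIndependent_iff]
  intro c hc
  have hs := congrArg (B s) hc
  have hl := congrArg (B l) hc
  have ha := congrArg (B a) hc
  have hn := congrArg (B n) hc
  simp [Fin.sum_univ_four, h.ss, h.sl, h.sa, h.sn] at hs
  simp [Fin.sum_univ_four, h.ls, h.ll, h.la, h.ln] at hl
  simp [Fin.sum_univ_four, h.as, h.al, h.aa, h.an] at ha
  simp [Fin.sum_univ_four, h.ns, h.nl, h.na, h.nn] at hn
  intro i
  fin_cases i <;> simp [hs, hl, ha, hn]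

theorem span_eq_top (h : IsNullFrame B s l a n) :
    Submodule.span ℝ (Set.range ![s, l, a, n]) = ⊤ :=
  h.linearIndependent.span_eq_top_of_card_eq_finrank (by simp)

/-- The expansion of a vector in a null frame. -/
theorem expand (h : IsNullFrame B s l a n) (v : E4) :
    v = B s v • s + B a v • a - B l v • n - B n v • l := by
  have hv : v ∈ Submodule.span ℝ (Set.range ![s, l, a, n]) := by
    rw [h.span_eq_top]; trivial
  induction hv using Submodule.span_induction with
  | mem x hx =>
    obtain ⟨i, rfl⟩ := hx
    fin_cases i
    · simp [h.ss, h.as, h.ls, h.ns]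
    · simp [h.sl, h.al, h.ll, h.nl]
    · simp [h.sa, h.aa, h.la, h.na]
    · simp [h.sn, h.an, h.ln, h.nn]
  | zero => simp
  | add x y _ _ hx hy =>
    conv_lhs => rw [hx, hy]
    simp only [map_add, add_smul]
    abel
  | smul c x _ hx =>
    conv_lhs => rw [hx]
    simp only [map_smul, smul_eq_mul, mul_smul, smul_add, smul_sub]

theorem isInvertible (h : IsNullFrame B s l a n) : B.IsInvertible := by
  have hinj : Function.Injective B := by
    rw [injective_iff_map_eq_zero]
    intro v hv
    rw [h.expand v]
    simp [h.symm _ v, hv]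
  have hdim : Module.finrank ℝ E4 = Module.finrank ℝ (E4 →L[ℝ] ℝ) := by
    have e : (E4 →ₗ[ℝ] ℝ) ≃ₗ[ℝ] (E4 →L[ℝ] ℝ) := LinearMap.toContinuousLinearMap
    rw [← e.finrank_eq, Module.finrank_linearMap]
    simp
  refine ⟨(LinearEquiv.ofInjectiveOfFinrankEq B.toLinearMap hinj hdim).toContinuousLinearEquiv, ?_⟩
  ext v w
  rfl

theorem apply_sharpB (h : IsNullFrame B s l a n) (ξ : E4 →L[ℝ] ℝ) : B (sharpB B ξ) = ξ := by
  obtain ⟨e, rfl⟩ := h.isInvertible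
  simp [sharpB]

theorem apply_raised (h : IsNullFrame B s l a n) (v : E4) (i : Fin 4) : B v (raised B i) = v i := by
  rw [h.symm, raised, h.apply_sharpB]
  rfl

/-- A contraction over the coordinate frame, with one index raised, as a contraction over a null
frame. -/
theorem sum_raised (h : IsNullFrame B s l a n) (Φ : E4 → E4 → ℝ)
    (h₁ : ∀ y, IsLinearMap ℝ fun x => Φ x y) (h₂ : ∀ x, IsLinearMap ℝ (Φ x)) :
    ∑ i, Φ (raised B i) (stdVec i) = Φ s s + Φ a a - Φ l n - Φ n l := by
  have key : ∀ x v : E4, ∑ i, v i * Φ x (stdVec i) = Φ x v := fun x v => by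
    simpa using sum_coord_mul (LinearMap.toContinuousLinearMap (IsLinearMap.mk' _ (h₂ x))) v
  rw [← key s s, ← key a a, ← key l n, ← key n l, ← Finset.sum_add_distrib,
    ← Finset.sum_sub_distrib, ← Finset.sum_sub_distrib]
  refine Finset.sum_congr rfl fun i _ => ?_
  conv_lhs => rw [h.expand (raised B i)]
  simp only [h.apply_raised]
  have hadd := fun y => (h₁ y).map_add
  have hsub := fun y => (h₁ y).map_sub
  have hsmul := fun y => (h₁ y).map_smul
  simp only [hadd, hsub, hsmul, smul_eq_mul]
  ring

end IsNullFrame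

/-! ### The Hodge star in a null frame -/

section slots

variable {V : Type*} [AddCommGroup V] [Module ℝ V] [TopologicalSpace V]

theorem isLinearMap_update {k : ℕ} (η : V [⋀^Fin k]→L[ℝ] ℝ) (v : Fin k → V) (i : Fin k) :
    IsLinearMap ℝ fun x => η (Function.update v i x) :=
  ⟨fun x y => η.map_update_add v i x y, fun c x => η.map_update_smul v i c x⟩

theorem isLinearMap_altForm₂_fst (η : V [⋀^Fin 2]→L[ℝ] ℝ) (y : V) :
    IsLinearMap ℝ fun x => η ![x, y] := by
  convert isLinearMap_update η ![0, y] 0 using 3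
  ext i; fin_cases i <;> simp

theorem isLinearMap_altForm₃_fst (η : V [⋀^Fin 3]→L[ℝ] ℝ) (y z : V) :
    IsLinearMap ℝ fun x => η ![x, y, z] := by
  convert isLinearMap_update η ![0, y, z] 0 using 3
  ext i; fin_cases i <;> simp

theorem isLinearMap_altForm₃_snd (η : V [⋀^Fin 3]→L[ℝ] ℝ) (x z : V) :
    IsLinearMap ℝ fun y => η ![x, y, z] := by
  convert isLinearMap_update η ![x, 0, z] 1 using 3
  ext i; fin_cases i <;> simp

theorem isLinearMap_altForm₃_trd (η : V [⋀^Fin 3]→L[ℝ] ℝ) (x y : V) :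
    IsLinearMap ℝ fun z => η ![x, y, z] := by
  convert isLinearMap_update η ![x, y, 0] 2 using 3
  ext i; fin_cases i <;> simp

theorem isLinearMap_altForm₄ (η : V [⋀^Fin 4]→L[ℝ] ℝ) (w x y z : V) :
    (IsLinearMap ℝ fun w => η ![w, x, y, z]) ∧ (IsLinearMap ℝ fun x => η ![w, x, y, z]) ∧
    (IsLinearMap ℝ fun y => η ![w, x, y, z]) ∧ (IsLinearMap ℝ fun z => η ![w, x, y, z]) := by
  refine ⟨?_, ?_, ?_, ?_⟩
  · convert isLinearMap_update η ![0, x, y, z] 0 using 3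
    ext i; fin_cases i <;> simp
  · convert isLinearMap_update η ![w, 0, y, z] 1 using 3
    ext i; fin_cases i <;> simp
  · convert isLinearMap_update η ![w, x, 0, z] 2 using 3
    ext i; fin_cases i <;> simp
  · convert isLinearMap_update η ![w, x, y, 0] 3 using 3
    ext i; fin_cases i <;> simp

theorem altForm_comp_swap {k : ℕ} (η : V [⋀^Fin k]→L[ℝ] ℝ) (v : Fin k → V) {i j : Fin k}
    (hij : i ≠ j) : η (v ∘ Equiv.swap i j) = -η v :=
  η.toAlternatingMap.map_swap v hij

theorem altForm₂_self (η : V [⋀^Fin 2]→L[ℝ] ℝ) (x : V) : η ![x, x] = 0 :=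
  η.map_eq_zero_of_eq (i := 0) (j := 1) _ rfl (by decide)

theorem altForm₂_swap (η : V [⋀^Fin 2]→L[ℝ] ℝ) (x y : V) : η ![y, x] = -η ![x, y] := by
  rw [← altForm_comp_swap η _ (show (0 : Fin 2) ≠ 1 by decide)]
  congr 1; ext i; fin_cases i <;> rfl

theorem altForm₃_swap (η : V [⋀^Fin 3]→L[ℝ] ℝ) (x y z : V) :
    η ![y, x, z] = -η ![x, y, z] ∧ η ![x, z, y] = -η ![x, y, z] := by
  constructor
  · rw [← altForm_comp_swap η _ (show (0 : Fin 3) ≠ 1 by decide)]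
    congr 1; ext i; fin_cases i <;> rfl
  · rw [← altForm_comp_swap η _ (show (1 : Fin 3) ≠ 2 by decide)]
    congr 1; ext i; fin_cases i <;> rfl

theorem altForm₄_self (η : V [⋀^Fin 4]→L[ℝ] ℝ) (x y z : V) :
    η ![x, x, y, z] = 0 ∧ η ![x, y, x, z] = 0 ∧ η ![x, y, z, x] = 0 ∧
    η ![y, x, x, z] = 0 ∧ η ![y, x, z, x] = 0 ∧ η ![y, z, x, x] = 0 :=
  ⟨η.map_eq_zero_of_eq (i := 0) (j := 1) _ rfl (by decide),
   η.map_eq_zero_of_eq (i := 0) (j := 2) _ rfl (by decide),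
   η.map_eq_zero_of_eq (i := 0) (j := 3) _ rfl (by decide),
   η.map_eq_zero_of_eq (i := 1) (j := 2) _ rfl (by decide),
   η.map_eq_zero_of_eq (i := 1) (j := 3) _ rfl (by decide),
   η.map_eq_zero_of_eq (i := 2) (j := 3) _ rfl (by decide)⟩

theorem altForm₄_swap (η : V [⋀^Fin 4]→L[ℝ] ℝ) (w x y z : V) :
    η ![x, w, y, z] = -η ![w, x, y, z] ∧ η ![w, y, x, z] = -η ![w, x, y, z] ∧
    η ![w, x, z, y] = -η ![w, x, y, z] := by
  refine ⟨?_, ?_, ?_⟩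
  · rw [← altForm_comp_swap η _ (show (0 : Fin 4) ≠ 1 by decide)]
    congr 1; ext i; fin_cases i <;> rfl
  · rw [← altForm_comp_swap η _ (show (1 : Fin 4) ≠ 2 by decide)]
    congr 1; ext i; fin_cases i <;> rfl
  · rw [← altForm_comp_swap η _ (show (2 : Fin 4) ≠ 3 by decide)]
    congr 1; ext i; fin_cases i <;> rfl

theorem altForm₃_perm (η : V [⋀^Fin 3]→L[ℝ] ℝ) (x y z : V) :
    η ![y, x, z] = -η ![x, y, z] ∧ η ![x, z, y] = -η ![x, y, z] ∧ η ![y, z, x] = η ![x, y, z] ∧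
    η ![z, x, y] = η ![x, y, z] ∧ η ![z, y, x] = -η ![x, y, z] := by
  have sw := altForm₃_swap η
  refine ⟨(sw x y z).1, (sw x y z).2, ?_, ?_, ?_⟩
  · rw [(sw y x z).2, (sw x y z).1, neg_neg]
  · rw [(sw x z y).1, (sw x y z).2, neg_neg]
  · rw [(sw y z x).1, (sw y x z).2, (sw x y z).1, neg_neg]

theorem altForm₄_perm (η : V [⋀^Fin 4]→L[ℝ] ℝ) (x y z w : V) :
    η ![y, x, z, w] = -η ![x, y, z, w] ∧ η ![x, z, y, w] = -η ![x, y, z, w] ∧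
    η ![y, z, x, w] = η ![x, y, z, w] ∧ η ![z, x, y, w] = η ![x, y, z, w] ∧
    η ![z, y, x, w] = -η ![x, y, z, w] := by
  have s1 := fun x y z => (altForm₄_swap η x y z w).1
  have s2 := fun x y z => (altForm₄_swap η x y z w).2.1
  refine ⟨s1 x y z, s2 x y z, ?_, ?_, ?_⟩
  · rw [s2 y x z, s1 x y z, neg_neg]
  · rw [s1 x z y, s2 x y z, neg_neg]
  · rw [s1 y z x, s2 y x z, s1 x y z, neg_neg]

end slots

/-- Fully contracting `dx^a ∧ dx^b` against a bilinear function of the coordinate vectors. -/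
theorem sum_coord_mul_coord_mul (Φ : E4 → E4 → ℝ)
    (h₁ : ∀ y, IsLinearMap ℝ fun x => Φ x y) (h₂ : ∀ x, IsLinearMap ℝ (Φ x)) (v w : E4) :
    ∑ i, ∑ j, v i * w j * Φ (stdVec i) (stdVec j) = Φ v w := by
  have key₂ : ∀ x v : E4, ∑ i, v i * Φ x (stdVec i) = Φ x v := fun x v => by
    simpa using sum_coord_mul (LinearMap.toContinuousLinearMap (IsLinearMap.mk' _ (h₂ x))) v
  have key₁ : ∀ y v : E4, ∑ i, v i * Φ (stdVec i) y = Φ v y := fun y v => by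
    simpa using sum_coord_mul (LinearMap.toContinuousLinearMap (IsLinearMap.mk' _ (h₁ y))) v
  simp only [mul_assoc, ← Finset.mul_sum, key₂, key₁]

namespace IsNullFrame

variable {B : E4 →L[ℝ] E4 →L[ℝ] ℝ} {s l a n : E4}

/-- The simple form `a♭ ∧ l♭` with `l` null and orthogonal to `a` squares to zero. -/
theorem formSq_smul_wedge (h : IsNullFrame B s l a n) (c : ℝ) :
    formSq B (c • wedge₁ (B a) (B l)) = 0 := by
  unfold formSq
  have e : ∀ i j, (c • wedge₁ (B a) (B l)) ![stdVec i, stdVec j] *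
      (c • wedge₁ (B a) (B l)) ![raised B i, raised B j] =
      a i * l j * (c ^ 2 * wedge₁ (B a) (B l) ![stdVec i, stdVec j]) -
      l i * a j * (c ^ 2 * wedge₁ (B a) (B l) ![stdVec i, stdVec j]) := by
    intro i j
    simp only [ContinuousAlternatingMap.smul_apply, wedge₁_apply, h.apply_raised, smul_eq_mul]
    ring
  have hΦ := sum_coord_mul_coord_mul (fun x y => c ^ 2 * wedge₁ (B a) (B l) ![x, y])
    (fun y => by constructor <;> intros <;> simp <;> ring)
    (fun y => by constructor <;> intros <;> simp <;> ring)
  simp only [e, Finset.sum_sub_distrib, hΦ]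
  simp [h.aa, h.al, h.la, h.ll]

/-- The dual of `a♭ ∧ l♭` is `± s♭ ∧ l♭`, the sign being the orientation of the frame. -/
theorem hodgeStar₂_smul_wedge (h : IsNullFrame B s l a n) (c : ℝ) :
    hodgeStar₂ B (c • wedge₁ (B a) (B l)) =
      (volForm B ![s, l, a, n] * c) • wedge₁ (B s) (B l) := by
  set ν := volForm B
  have lin := isLinearMap_altForm₄ ν
  ext v
  obtain ⟨x, y, rfl⟩ : ∃ x y, v = ![x, y] := ⟨v 0, v 1, by ext i; fin_cases i <;> rfl⟩
  have e : ∀ i j, (c • wedge₁ (B a) (B l)) ![raised B i, raised B j] *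
      ν ![stdVec i, stdVec j, x, y] =
      a i * l j * (c * ν ![stdVec i, stdVec j, x, y]) -
      l i * a j * (c * ν ![stdVec i, stdVec j, x, y]) := by
    intro i j
    simp only [ContinuousAlternatingMap.smul_apply, wedge₁_apply, h.apply_raised, smul_eq_mul]
    ring
  have hΦ := sum_coord_mul_coord_mul (fun x' y' => c * ν ![x', y', x, y])
    (fun z => by
      constructor <;> intros
      · simp only [(lin 0 z x y).1.map_add]; ring
      · simp only [(lin 0 z x y).1.map_smul, smul_eq_mul]; ring)
    (fun z => by
      constructor <;> intros
      · simp only [(lin z 0 x y).2.1.map_add]; ring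
      · simp only [(lin z 0 x y).2.1.map_smul, smul_eq_mul]; ring)
  have hsum : hodgeStar₂ B (c • wedge₁ (B a) (B l)) ![x, y] = c * ν ![a, l, x, y] := by
    have : hodgeStar₂ B (c • wedge₁ (B a) (B l)) ![x, y] = (1 / 2 : ℝ) *
        ∑ i, ∑ j, (c • wedge₁ (B a) (B l)) ![raised B i, raised B j] *
          ν ![stdVec i, stdVec j, x, y] := by
      simp only [hodgeStar₂, ContinuousAlternatingMap.smul_apply,
        ContinuousAlternatingMap.sum_apply, smul_eq_mul]
      rfl
    rw [this]
    simp only [e, Finset.sum_sub_distrib, hΦ]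
    rw [(altForm₄_swap ν a l x y).1]
    ring
  rw [hsum]
  conv_lhs => rw [h.expand x, h.expand y]
  simp only [fun w x y => (lin w x 0 y).2.2.1.map_add, fun w x y => (lin w x 0 y).2.2.1.map_sub,
    fun w x y => (lin w x 0 y).2.2.1.map_smul, fun w x y => (lin w x y 0).2.2.2.map_add,
    fun w x y => (lin w x y 0).2.2.2.map_sub, fun w x y => (lin w x y 0).2.2.2.map_smul,
    (altForm₄_self ν _ _ _).2.1, (altForm₄_self ν _ _ _).2.2.1, (altForm₄_self ν _ _ _).2.2.2.1,
    (altForm₄_self ν _ _ _).2.2.2.2.1, (altForm₄_self ν _ _ _).2.2.2.2.2]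
  have e1 : ν ![a, l, n, s] = -ν ![a, l, s, n] := (altForm₄_swap ν a l s n).2.2
  have e2 : ν ![a, l, s, n] = -ν ![s, l, a, n] := by
    rw [(altForm₄_swap ν l a s n).1, (altForm₄_swap ν l s a n).2.1, (altForm₄_swap ν s l a n).1]; ring
  rw [e1, e2]
  simp only [ContinuousAlternatingMap.smul_apply, wedge₁_apply, smul_eq_mul]
  ring

/-- Two components of the dual of a three-form, in a null frame. Those along `l` and `a` decide
whether the raised dual is tangent to the plane of `s` and `l`. -/
theorem hodgeStar₃_apply (h : IsNullFrame B s l a n) (η : E4 [⋀^Fin 3]→L[ℝ] ℝ) :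
    hodgeStar₃ B η ![l] = volForm B ![s, l, a, n] * η ![s, l, a] ∧
    hodgeStar₃ B η ![a] = volForm B ![s, l, a, n] * η ![s, l, n] := by
  set ν := volForm B
  have hsum : ∀ z, hodgeStar₃ B η ![z] = (1 / 6 : ℝ) *
      ∑ i, ∑ j, ∑ k, η ![raised B i, raised B j, raised B k] *
        ν ![stdVec i, stdVec j, stdVec k, z] := by
    intro z
    simp only [hodgeStar₃, ContinuousAlternatingMap.smul_apply,
      ContinuousAlternatingMap.sum_apply, smul_eq_mul]
    rfl
  have h3 : ∀ x y x' y' z, ∑ k, η ![x, y, raised B k] * ν ![x', y', stdVec k, z] =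
      η ![x, y, s] * ν ![x', y', s, z] + η ![x, y, a] * ν ![x', y', a, z] -
      η ![x, y, l] * ν ![x', y', n, z] - η ![x, y, n] * ν ![x', y', l, z] := fun x y x' y' z =>
    h.sum_raised (fun u v => η ![x, y, u] * ν ![x', y', v, z])
      (fun v => by
        have := isLinearMap_altForm₃_trd η x y
        constructor <;> intros
        · simp only [this.map_add]; ring
        · simp only [this.map_smul, smul_eq_mul]; ring)
      (fun u => by
        have := (isLinearMap_altForm₄ ν x' y' 0 z).2.2.1
        constructor <;> intros
        · simp only [this.map_add]; ring
        · simp only [this.map_smul, smul_eq_mul]; ring)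
  have h2 : ∀ x y x' y' z, ∑ j, η ![x, raised B j, y] * ν ![x', stdVec j, y', z] =
      η ![x, s, y] * ν ![x', s, y', z] + η ![x, a, y] * ν ![x', a, y', z] -
      η ![x, l, y] * ν ![x', n, y', z] - η ![x, n, y] * ν ![x', l, y', z] := fun x y x' y' z =>
    h.sum_raised (fun u v => η ![x, u, y] * ν ![x', v, y', z])
      (fun v => by
        have := isLinearMap_altForm₃_snd η x y
        constructor <;> intros
        · simp only [this.map_add]; ring
        · simp only [this.map_smul, smul_eq_mul]; ring)
      (fun u => by
        have := (isLinearMap_altForm₄ ν x' 0 y' z).2.1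
        constructor <;> intros
        · simp only [this.map_add]; ring
        · simp only [this.map_smul, smul_eq_mul]; ring)
  have h1 : ∀ x y x' y' z, ∑ i, η ![raised B i, x, y] * ν ![stdVec i, x', y', z] =
      η ![s, x, y] * ν ![s, x', y', z] + η ![a, x, y] * ν ![a, x', y', z] -
      η ![l, x, y] * ν ![n, x', y', z] - η ![n, x, y] * ν ![l, x', y', z] := fun x y x' y' z =>
    h.sum_raised (fun u v => η ![u, x, y] * ν ![v, x', y', z])
      (fun v => by
        have := isLinearMap_altForm₃_fst η x y
        constructor <;> intros
        · simp only [this.map_add]; ring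
        · simp only [this.map_smul, smul_eq_mul]; ring)
      (fun u => by
        have := (isLinearMap_altForm₄ ν 0 x' y' z).1
        constructor <;> intros
        · simp only [this.map_add]; ring
        · simp only [this.map_smul, smul_eq_mul]; ring)
  have perm₃ := altForm₃_perm η
  have perm₄ := fun x y z => altForm₄_perm ν x y z
  have el : ν ![s, a, n, l] = ν ![s, l, a, n] := by
    rw [(altForm₄_swap ν s a l n).2.2, (altForm₄_swap ν s l a n).2.1, neg_neg]
  have ea : ν ![s, l, n, a] = -ν ![s, l, a, n] := (altForm₄_swap ν s l a n).2.2
  constructor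
  · rw [hsum]
    simp only [h1, h2, h3, Finset.sum_add_distrib, Finset.sum_sub_distrib,
      (altForm₄_self ν _ _ _).1, (altForm₄_self ν _ _ _).2.1, (altForm₄_self ν _ _ _).2.2.1,
      (altForm₄_self ν _ _ _).2.2.2.1, (altForm₄_self ν _ _ _).2.2.2.2.1, (altForm₄_self ν _ _ _).2.2.2.2.2,
      mul_zero, add_zero, zero_add, sub_zero, zero_sub]
    obtain ⟨p1, p2, p3, p4, p5⟩ := perm₃ s a l
    obtain ⟨q1, q2, q3, q4, q5⟩ := perm₄ s a n l
    rw [p1, p2, p3, p4, p5, q1, q2, q3, q4, q5, el, (altForm₃_swap η s l a).2]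
    ring
  · rw [hsum]
    simp only [h1, h2, h3, Finset.sum_neg_distrib, Finset.sum_sub_distrib,
      (altForm₄_self ν _ _ _).1, (altForm₄_self ν _ _ _).2.1, (altForm₄_self ν _ _ _).2.2.1,
      (altForm₄_self ν _ _ _).2.2.2.1, (altForm₄_self ν _ _ _).2.2.2.2.1, (altForm₄_self ν _ _ _).2.2.2.2.2,
      mul_zero, add_zero, sub_zero, zero_sub]
    obtain ⟨p1, p2, p3, p4, p5⟩ := perm₃ s l n
    obtain ⟨q1, q2, q3, q4, q5⟩ := perm₄ s l n a
    rw [p1, p2, p3, p4, p5, q1, q2, q3, q4, q5, ea]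
    ring

/-- The Gram determinant of a null frame is `-1`. -/
theorem det_mul_detForm_sq (h : IsNullFrame B s l a n) :
    Matrix.det (Matrix.of fun i j => B (stdVec i) (stdVec j)) * detForm ![s, l, a, n] ^ 2 = -1 := by
  set f : Fin 4 → E4 := ![s, l, a, n]
  let P : Matrix (Fin 4) (Fin 4) ℝ := Matrix.of fun i j => f i j
  have hP : detForm f = P.det := rfl
  have hgram : P * (Matrix.of fun i j => B (stdVec i) (stdVec j)) * P.transpose =
      Matrix.of fun i j => B (f i) (f j) := by
    ext i j
    rw [Matrix.of_apply, ← sum_coord_mul (B (f i)) (f j), Matrix.mul_apply]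
    refine Finset.sum_congr rfl fun k _ => ?_
    rw [← ContinuousLinearMap.flip_apply B, ← sum_coord_mul (B.flip (stdVec k)) (f i),
      Matrix.mul_apply, mul_comm]
    rfl
  have hdet := congrArg Matrix.det hgram
  rw [Matrix.det_mul, Matrix.det_mul, Matrix.det_transpose] at hdet
  have : Matrix.det (Matrix.of fun i j => B (f i) (f j)) = -1 := by
    simp [Matrix.det_succ_row_zero, Fin.sum_univ_succ, f, Fin.succAbove, h.ss,
      h.ls, h.ll, h.la, h.ln, h.as, h.al, h.aa, h.an, h.ns, h.nl, h.na, h.nn]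
  rw [hP, ← this, ← hdet]
  ring

/-- The volume of a null frame is its orientation. -/
theorem volForm_eq (h : IsNullFrame B s l a n) :
    detForm ![s, l, a, n] ≠ 0 ∧
      volForm B ![s, l, a, n] = detForm ![s, l, a, n] / |detForm ![s, l, a, n]| := by
  have hd := h.det_mul_detForm_sq
  set d := detForm ![s, l, a, n]
  set D := Matrix.det (Matrix.of fun i j => B (stdVec i) (stdVec j))
  have hd0 : d ≠ 0 := by rintro h0; simp [h0] at hd
  refine ⟨hd0, ?_⟩
  have hv : volForm B ![s, l, a, n] = √|D| * d := rfl
  have hD : |D| = (|d|⁻¹) ^ 2 := by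
    have hD' : D = -(d ^ 2)⁻¹ := by field_simp; linarith
    rw [hD', abs_neg, abs_inv, abs_pow, inv_pow]
  rw [hv, hD, Real.sqrt_sq (by positivity), div_eq_inv_mul]

end IsNullFrame

/-! ### Exterior derivatives of simple two-forms on `ℝ⁴` -/

theorem isBoundedBilinearMap_wedge₁ {E : Type*} [NormedAddCommGroup E] [NormedSpace ℝ E] :
    IsBoundedBilinearMap ℝ fun p : (E →L[ℝ] ℝ) × (E →L[ℝ] ℝ) => wedge₁ p.1 p.2 where
  add_left α α' β := by
    ext v
    change (α + α') (v 0) * β (v 1) - (α + α') (v 1) * β (v 0) =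
      (α (v 0) * β (v 1) - α (v 1) * β (v 0)) + (α' (v 0) * β (v 1) - α' (v 1) * β (v 0))
    simp; ring
  smul_left c α β := by
    ext v
    change (c • α) (v 0) * β (v 1) - (c • α) (v 1) * β (v 0) =
      c * (α (v 0) * β (v 1) - α (v 1) * β (v 0))
    simp; ring
  add_right α β β' := by
    ext v
    change α (v 0) * (β + β') (v 1) - α (v 1) * (β + β') (v 0) =
      (α (v 0) * β (v 1) - α (v 1) * β (v 0)) + (α (v 0) * β' (v 1) - α (v 1) * β' (v 0))
    simp; ring
  smul_right c α β := by
    ext v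
    change α (v 0) * (c • β) (v 1) - α (v 1) * (c • β) (v 0) =
      c * (α (v 0) * β (v 1) - α (v 1) * β (v 0))
    simp; ring
  bound := by
    refine ⟨2, by norm_num, fun α β => ?_⟩
    refine ContinuousAlternatingMap.opNorm_le_bound _ (by positivity) fun v => ?_
    change ‖α (v 0) * β (v 1) - α (v 1) * β (v 0)‖ ≤ _
    rw [Fin.prod_univ_two]
    calc ‖α (v 0) * β (v 1) - α (v 1) * β (v 0)‖
        ≤ ‖α (v 0)‖ * ‖β (v 1)‖ + ‖α (v 1)‖ * ‖β (v 0)‖ := by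
          rw [← norm_mul, ← norm_mul]; exact norm_sub_le _ _
      _ ≤ (‖α‖ * ‖v 0‖) * (‖β‖ * ‖v 1‖) + (‖α‖ * ‖v 1‖) * (‖β‖ * ‖v 0‖) := by
          gcongr <;> exact ContinuousLinearMap.le_opNorm _ _
      _ = 2 * ‖α‖ * ‖β‖ * (‖v 0‖ * ‖v 1‖) := by ring

/-- The Leibniz rule for the exterior derivative of `w α ∧ β`, written out on three vectors. -/
theorem extDeriv_smul_wedge₁ {w : E4 → ℝ} {α β : E4 → E4 →L[ℝ] ℝ} {w' : E4 →L[ℝ] ℝ}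
    {α' β' : E4 →L[ℝ] E4 →L[ℝ] ℝ} {y : E4} (hw : HasFDerivAt w w' y)
    (hα : HasFDerivAt α α' y) (hβ : HasFDerivAt β β' y) (X Y Z : E4) :
    extDeriv (fun y => w y • wedge₁ (α y) (β y)) y ![X, Y, Z] =
      (w' X * (α y Y * β y Z - α y Z * β y Y) + w y *
        (α' X Y * β y Z - α' X Z * β y Y + (α y Y * β' X Z - α y Z * β' X Y))) -
      (w' Y * (α y X * β y Z - α y Z * β y X) + w y *
        (α' Y X * β y Z - α' Y Z * β y X + (α y X * β' Y Z - α y Z * β' Y X))) +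
      (w' Z * (α y X * β y Y - α y Y * β y X) + w y *
        (α' Z X * β y Y - α' Z Y * β y X + (α y X * β' Z Y - α y Y * β' Z X))) := by
  have hwedge : HasFDerivAt (fun y => wedge₁ (α y) (β y))
      ((isBoundedBilinearMap_wedge₁.deriv (α y, β y)).comp (α'.prod β')) y :=
    HasFDerivAt.comp (g := fun p : (E4 →L[ℝ] ℝ) × (E4 →L[ℝ] ℝ) => wedge₁ p.1 p.2) y
      (isBoundedBilinearMap_wedge₁.hasFDerivAt (α y, β y)) (hα.prodMk hβ)
  have hD : ∀ v a b, fderiv ℝ (fun y => (w y • wedge₁ (α y) (β y)) ![a, b]) y v =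
      w' v * (α y a * β y b - α y b * β y a) + w y *
        (α' v a * β y b - α' v b * β y a + (α y a * β' v b - α y b * β' v a)) := by
    intro v a b
    have ha := fun c => hα.clm_apply (hasFDerivAt_const c y)
    have hb := fun c => hβ.clm_apply (hasFDerivAt_const c y)
    have h := hw.mul (((ha a).mul (hb b)).sub ((ha b).mul (hb a)))
    rw [show (fun y => (w y • wedge₁ (α y) (β y)) ![a, b]) =
      w * ((fun y => α y a) * (fun y => β y b) - (fun y => α y b) * (fun y => β y a)) from rfl,
      h.fderiv]
    simp
    ring
  have e0 : Fin.removeNth (0 : Fin 3) ![X, Y, Z] = ![Y, Z] := by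
    ext i; fin_cases i <;> rfl
  have e1 : Fin.removeNth (1 : Fin 3) ![X, Y, Z] = ![X, Z] := by
    ext i; fin_cases i <;> rfl
  have e2 : Fin.removeNth (2 : Fin 3) ![X, Y, Z] = ![X, Y] := by
    ext i; fin_cases i <;> rfl
  rw [extDeriv_apply (hw.fun_smul hwedge).differentiableAt, Fin.sum_univ_three, e0, e1, e2]
  simp only [hD, Matrix.cons_val_zero, Matrix.cons_val_one, Matrix.cons_val_two, Matrix.head_cons,
    Matrix.tail_cons]
  simp
  ring

/-! ### The Levi-Civita derivative on `ℝ⁴` -/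

/-- A shortcut: instance search does not find this norm within its default budget. -/
instance instNormedAddCommGroupBilin : NormedAddCommGroup (E4 →L[ℝ] E4 →L[ℝ] ℝ) :=
  ContinuousLinearMap.toNormedAddCommGroup

instance instNormedSpaceBilin : NormedSpace ℝ (E4 →L[ℝ] E4 →L[ℝ] ℝ) :=
  ContinuousLinearMap.toNormedSpace

/-- The covariant derivative `∇_v Y` at `y` of a vector field on `ℝ⁴` with the metric `G`. -/
def covD (G : E4 → E4 →L[ℝ] E4 →L[ℝ] ℝ) (Y : E4 → E4) (y v : E4) : E4 :=
  fderiv ℝ Y y v + sharpB (G y) (christoffelLower G y v (Y y))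

theorem christoffelLower_apply (G : E4 → E4 →L[ℝ] E4 →L[ℝ] ℝ) (y v w z : E4) :
    christoffelLower G y v w z =
      (1 / 2) * (fderiv ℝ G y v w z + fderiv ℝ G y w v z - fderiv ℝ G y z v w) := by
  simp [christoffelLower]

set_option synthInstance.maxHeartbeats 200000 in
theorem covD_combination (G : E4 → E4 →L[ℝ] E4 →L[ℝ] ℝ) (Y : E4 → E4) (y : E4) (c d : ℝ)
    (v w : E4) : covD G Y y (c • v + d • w) = c • covD G Y y v + d • covD G Y y w := by
  have : christoffelLower G y (c • v + d • w) (Y y) =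
      c • christoffelLower G y v (Y y) + d • christoffelLower G y w (Y y) := by
    ext z
    simp only [add_apply, smul_apply, christoffelLower_apply, map_add, map_smul, smul_eq_mul]
    ring
  simp only [covD, sharpB, this, map_add, map_smul]
  module

section frame

variable {G : E4 → E4 →L[ℝ] E4 →L[ℝ] ℝ} {s l a n : E4 → E4} {y : E4}

/-- A differentiable null frame, near the point `y`, of a differentiable metric on `ℝ⁴`. -/
structure IsNullFrameNear (G : E4 → E4 →L[ℝ] E4 →L[ℝ] ℝ) (s l a n : E4 → E4) (y : E4) : Prop where
  metric : DifferentiableAt ℝ G y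
  diff_s : DifferentiableAt ℝ s y
  diff_l : DifferentiableAt ℝ l y
  diff_a : DifferentiableAt ℝ a y
  diff_n : DifferentiableAt ℝ n y
  frame : ∀ᶠ z in 𝓝 y, IsNullFrame (G z) (s z) (l z) (a z) (n z)

namespace IsNullFrameNear

theorem swap (h : IsNullFrameNear G s l a n y) : IsNullFrameNear G a l s n y :=
  ⟨h.metric, h.diff_a, h.diff_l, h.diff_s, h.diff_n, h.frame.mono fun _ hz => hz.swap⟩

theorem self (h : IsNullFrameNear G s l a n y) : IsNullFrame (G y) (s y) (l y) (a y) (n y) :=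
  h.frame.self_of_nhds

theorem fderiv_symm (h : IsNullFrameNear G s l a n y) (u v w : E4) :
    fderiv ℝ G y u v w = fderiv ℝ G y u w v := by
  have e : ∀ v w, HasFDerivAt (fun z => G z v w)
      ((ContinuousLinearMap.apply ℝ ℝ w ∘L ContinuousLinearMap.apply ℝ (E4 →L[ℝ] ℝ) v) ∘L
        fderiv ℝ G y) y := fun v w =>
    (ContinuousLinearMap.apply ℝ ℝ w ∘L
      ContinuousLinearMap.apply ℝ (E4 →L[ℝ] ℝ) v).hasFDerivAt.comp y h.metric.hasFDerivAt
  have h2 : (fun z => G z v w) =ᶠ[𝓝 y] fun z => G z w v := h.frame.mono fun z hz => hz.symm v w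
  exact congrArg (fun f : E4 →L[ℝ] ℝ => f u) ((e v w).unique ((e w v).congr_of_eventuallyEq h2))

theorem apply_covD (h : IsNullFrameNear G s l a n y) (Y : E4 → E4) (v z : E4) :
    G y (covD G Y y v) z = G y (fderiv ℝ Y y v) z + (1 / 2) * (fderiv ℝ G y v (Y y) z +
      fderiv ℝ G y (Y y) v z - fderiv ℝ G y z v (Y y)) := by
  rw [covD, map_add, h.self.apply_sharpB, add_apply, christoffelLower_apply]

theorem hasFDerivAt_flat (h : IsNullFrameNear G s l a n y) {Y : E4 → E4}
    (hY : DifferentiableAt ℝ Y y) :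
    HasFDerivAt (fun z => G z (Y z)) (G y ∘L fderiv ℝ Y y + (fderiv ℝ G y).flip (Y y)) y :=
  h.metric.hasFDerivAt.clm_apply hY.hasFDerivAt

/-- The derivative of `Y♭` is `∇Y` up to a tensor symmetric in its two arguments. -/
theorem flat_deriv (h : IsNullFrameNear G s l a n y) (Y : E4 → E4) :
    ∃ K : E4 → E4 → ℝ, (∀ v z, K v z = K z v) ∧ ∀ v z,
      (G y ∘L fderiv ℝ Y y + (fderiv ℝ G y).flip (Y y)) v z = G y (covD G Y y v) z + K v z := by
  refine ⟨fun v z => (1 / 2) * (fderiv ℝ G y v (Y y) z - fderiv ℝ G y (Y y) v z +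
    fderiv ℝ G y z v (Y y)), fun v z => ?_, fun v z => ?_⟩
  · beta_reduce
    rw [h.fderiv_symm v z, h.fderiv_symm (Y y) z v, h.fderiv_symm z v]
    ring
  · rw [h.apply_covD]
    simp only [add_apply, ContinuousLinearMap.comp_apply,
      ContinuousLinearMap.flip_apply]
    ring

/-- The Levi-Civita derivative is compatible with the metric. -/
theorem covD_compat (h : IsNullFrameNear G s l a n y) {X Y : E4 → E4}
    (hX : DifferentiableAt ℝ X y) (hY : DifferentiableAt ℝ Y y) {c : ℝ}
    (hc : ∀ᶠ z in 𝓝 y, G z (X z) (Y z) = c) (v : E4) :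
    G y (covD G X y v) (Y y) + G y (covD G Y y v) (X y) = 0 := by
  have h1 := (h.hasFDerivAt_flat hX).clm_apply hY.hasFDerivAt
  have h2 : HasFDerivAt (fun z => G z (X z) (Y z)) (0 : E4 →L[ℝ] ℝ) y :=
    (hasFDerivAt_const c y).congr_of_eventuallyEq hc
  have h3 := congrArg (fun f : E4 →L[ℝ] ℝ => f v) (h1.unique h2)
  simp only [add_apply, ContinuousLinearMap.comp_apply,
    ContinuousLinearMap.flip_apply, zero_apply] at h3
  rw [h.apply_covD, h.apply_covD, h.self.symm (fderiv ℝ Y y v), h.fderiv_symm v (Y y),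
    h.fderiv_symm (X y) v, h.fderiv_symm (Y y) v]
  linarith

/-- The exterior derivative of `w X♭ ∧ Y♭` in terms of covariant derivatives. -/
theorem extDeriv_flat_wedge (h : IsNullFrameNear G s l a n y) {X Y : E4 → E4} {w : E4 → ℝ}
    (hX : DifferentiableAt ℝ X y) (hY : DifferentiableAt ℝ Y y) (hw : DifferentiableAt ℝ w y)
    (u v z : E4) :
    extDeriv (fun y => w y • wedge₁ (G y (X y)) (G y (Y y))) y ![u, v, z] =
      (fderiv ℝ w y u * (G y (X y) v * G y (Y y) z - G y (X y) z * G y (Y y) v) + w y *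
        (G y (covD G X y u) v * G y (Y y) z - G y (covD G X y u) z * G y (Y y) v +
          (G y (X y) v * G y (covD G Y y u) z - G y (X y) z * G y (covD G Y y u) v))) -
      (fderiv ℝ w y v * (G y (X y) u * G y (Y y) z - G y (X y) z * G y (Y y) u) + w y *
        (G y (covD G X y v) u * G y (Y y) z - G y (covD G X y v) z * G y (Y y) u +
          (G y (X y) u * G y (covD G Y y v) z - G y (X y) z * G y (covD G Y y v) u))) +
      (fderiv ℝ w y z * (G y (X y) u * G y (Y y) v - G y (X y) v * G y (Y y) u) + w y *
        (G y (covD G X y z) u * G y (Y y) v - G y (covD G X y z) v * G y (Y y) u +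
          (G y (X y) u * G y (covD G Y y z) v - G y (X y) v * G y (covD G Y y z) u))) := by
  obtain ⟨K, hK, eK⟩ := h.flat_deriv X
  obtain ⟨J, hJ, eJ⟩ := h.flat_deriv Y
  rw [extDeriv_smul_wedge₁ hw.hasFDerivAt (h.hasFDerivAt_flat hX) (h.hasFDerivAt_flat hY)]
  simp only [eK, eJ]
  rw [hK v u, hK z u, hK z v, hJ v u, hJ z u, hJ z v]
  ring

/-- `∇l` is orthogonal to `l`, because `l` is null. -/
theorem covD_self (h : IsNullFrameNear G s l a n y) (v : E4) : G y (covD G l y v) (l y) = 0 := by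
  have := h.covD_compat h.diff_l h.diff_l (h.frame.mono fun z hz => hz.ll) v
  linarith

/-- The component along `s, l, a` of `d(w s♭ ∧ l♭)`: it measures the acceleration of `l` along
`a`. -/
theorem extDeriv_sla (h : IsNullFrameNear G s l a n y) {w : E4 → ℝ}
    (hw : DifferentiableAt ℝ w y) :
    extDeriv (fun y => w y • wedge₁ (G y (s y)) (G y (l y))) y ![s y, l y, a y] =
      -(w y * G y (covD G l y (l y)) (a y)) := by
  have f := h.self
  rw [h.extDeriv_flat_wedge h.diff_s h.diff_l hw]
  simp only [f.ss, f.ll, f.ls, f.la, f.sl, f.sa, h.covD_self]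
  ring

/-- The component along `s, l, n` of `d(w s♭ ∧ l♭)`. Only its first term involves `s`, so it differs
from the corresponding component of `d(w a♭ ∧ l♭)` by the difference of the two expansions. -/
theorem extDeriv_sln (h : IsNullFrameNear G s l a n y) {w : E4 → ℝ}
    (hw : DifferentiableAt ℝ w y) :
    extDeriv (fun y => w y • wedge₁ (G y (s y)) (G y (l y))) y ![s y, l y, n y] =
      w y * G y (covD G l y (s y)) (s y) + fderiv ℝ w y (l y) -
        w y * G y (covD G l y (l y)) (n y) := by
  have f := h.self
  have h1 := h.covD_compat h.diff_s h.diff_l (h.frame.mono fun z hz => hz.sl) (s y)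
  have h2 := h.covD_compat h.diff_s h.diff_s (h.frame.mono fun z hz => hz.ss) (l y)
  rw [h.extDeriv_flat_wedge h.diff_s h.diff_l hw]
  simp only [f.ss, f.ll, f.ls, f.ln, f.sl, f.sn, h.covD_self]
  linear_combination (-w y) * h1 + (w y / 2) * h2

/-- The dual of `w a♭ ∧ l♭` is `± w s♭ ∧ l♭` with a locally constant sign, so the dual form has the
exterior derivative of `w s♭ ∧ l♭` up to sign. -/
theorem extDeriv_hodgeStar₂ (h : IsNullFrameNear G s l a n y) (w : E4 → ℝ)
    {F : E4 → E4 [⋀^Fin 2]→L[ℝ] ℝ}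
    (hF : ∀ᶠ z in 𝓝 y, F z = w z • wedge₁ (G z (a z)) (G z (l z))) :
    ∃ ε : ℝ, ε ≠ 0 ∧ extDeriv (fun z => hodgeStar₂ (G z) (F z)) y =
      ε • extDeriv (fun y => w y • wedge₁ (G y (s y)) (G y (l y))) y := by
  set d : E4 → ℝ := fun z => detForm ![s z, l z, a z, n z]
  have hd : ContinuousAt d y := by
    refine detForm.cont.continuousAt.comp (continuousAt_pi.2 fun i => ?_)
    fin_cases i
    · exact h.diff_s.continuousAt
    · exact h.diff_l.continuousAt
    · exact h.diff_a.continuousAt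
    · exact h.diff_n.continuousAt
  have hd0 : d y ≠ 0 := h.self.volForm_eq.1
  have hsign : ∀ᶠ z in 𝓝 y, d z / |d z| = d y / |d y| := by
    rcases lt_or_gt_of_ne hd0 with h0 | h0
    · filter_upwards [hd.eventually_lt_const h0] with z hz
      rw [abs_of_neg hz, abs_of_neg h0, div_neg, div_neg, div_self hz.ne, div_self h0.ne]
    · filter_upwards [hd.eventually_const_lt h0] with z hz
      rw [abs_of_pos hz, abs_of_pos h0, div_self hz.ne', div_self h0.ne']
  refine ⟨d y / |d y|, div_ne_zero hd0 (abs_ne_zero.2 hd0), ?_⟩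
  have key : (fun z => hodgeStar₂ (G z) (F z)) =ᶠ[𝓝 y]
      (d y / |d y|) • fun z => w z • wedge₁ (G z (s z)) (G z (l z)) := by
    filter_upwards [hF, h.frame, hsign] with z h1 h2 h3
    rw [h1, h2.hodgeStar₂_smul_wedge, h2.volForm_eq.2, mul_smul]
    exact congrArg (· • _) h3
  rw [key.extDeriv_eq, extDeriv_smul]

/-- For a closed form `w a♭ ∧ l♭`, the current `* d *` is tangent to the plane of `s` and `l`
exactly when the acceleration of `l` along `a` and the difference of the two expansions vanish;
closedness moreover forces the acceleration along `s` to vanish. -/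
theorem current_iff (h : IsNullFrameNear G s l a n y) {w : E4 → ℝ} (hw : DifferentiableAt ℝ w y)
    {F : E4 → E4 [⋀^Fin 2]→L[ℝ] ℝ}
    (hF : ∀ᶠ z in 𝓝 y, F z = w z • wedge₁ (G z (a z)) (G z (l z))) (hd : extDeriv F y = 0) :
    w y * G y (covD G l y (l y)) (s y) = 0 ∧
    ((hodgeStar₃ (G y) (extDeriv (fun z => hodgeStar₂ (G z) (F z)) y) ![l y] = 0 ∧
      hodgeStar₃ (G y) (extDeriv (fun z => hodgeStar₂ (G z) (F z)) y) ![a y] = 0) ↔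
      (w y * G y (covD G l y (l y)) (a y) = 0 ∧
        w y * (G y (covD G l y (s y)) (s y) - G y (covD G l y (a y)) (a y)) = 0)) := by
  rw [Filter.EventuallyEq.extDeriv_eq hF] at hd
  have h1 := h.swap.extDeriv_sla hw
  have h2 := h.swap.extDeriv_sln hw
  rw [hd, ContinuousAlternatingMap.coe_zero, Pi.zero_apply] at h1 h2
  refine ⟨by linarith, ?_⟩
  obtain ⟨ε, hε, e⟩ := h.extDeriv_hodgeStar₂ w hF
  have hv : volForm (G y) ![s y, l y, a y, n y] ≠ 0 := by
    rw [h.self.volForm_eq.2]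
    exact div_ne_zero h.self.volForm_eq.1 (abs_ne_zero.2 h.self.volForm_eq.1)
  rw [(h.self.hodgeStar₃_apply _).1, (h.self.hodgeStar₃_apply _).2, e,
    ContinuousAlternatingMap.smul_apply, ContinuousAlternatingMap.smul_apply,
    h.extDeriv_sla hw, h.extDeriv_sln hw]
  simp only [smul_eq_mul, mul_eq_zero_iff_left hv, mul_eq_zero_iff_left hε, neg_eq_zero]
  refine and_congr Iff.rfl ?_
  constructor <;> intro h3 <;> linarith

end IsNullFrameNear

end frame

/-! ### Passing to the preferred chart -/

/-- A section of a bundle of tensors, read in the fixed vector space `ℝ⁴`, takes the same value at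
equal points. -/
theorem eq_of_point_eq {M T : Type*} (f : M → T) {x x' : M} (h : x' = x) : f x' = f x := by rw [h]

theorem eventually_mem_target {M : Type*} [TopologicalSpace M] [ChartedSpace E4 M] (x : M) :
    ∀ᶠ y in 𝓝 (extChartAt (𝓡 4) x x), y ∈ (extChartAt (𝓡 4) x).target :=
  extChartAt_target_mem_nhds x

section Spacetime

variable {M : Type*} [TopologicalSpace M] [ChartedSpace E4 M] [IsManifold (𝓡 4) ∞ M]

/-- The identification of the tangent space at `x` with the model space is the differential of the
preferred chart at `x`. So at the base point the coordinate expressions used in the definitions are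
the tensors themselves. -/
theorem chartDeriv_eq_id (x : M) : chartDeriv x = ContinuousLinearMap.id ℝ E4 :=
  mfderiv_extChartAt_self

theorem chartPush_self (x : M) :
    chartPush x (extChartAt (𝓡 4) x x) = ContinuousLinearMap.id ℝ E4 := by
  have := mfderivWithin_range_extChartAt_symm (I := 𝓡 4) (x := x)
  rw [ModelWithCorners.range_eq_univ, mfderivWithin_univ] at this
  exact this

theorem chartPush_isInvertible (x : M) {y : E4} (hy : y ∈ (extChartAt (𝓡 4) x).target) :
    (chartPush x y).IsInvertible := by
  have := isInvertible_mfderivWithin_extChartAt_symm (I := 𝓡 4) hy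
  rw [ModelWithCorners.range_eq_univ, mfderivWithin_univ] at this
  exact this

theorem chartPush_vfieldInChart (X : VField M) (x : M) {y : E4}
    (hy : y ∈ (extChartAt (𝓡 4) x).target) :
    chartPush x y (vfieldInChart X x y) = X ((extChartAt (𝓡 4) x).symm y) :=
  (chartPush_isInvertible x hy).self_apply_inverse _

theorem vfieldInChart_self (X : VField M) (x : M) :
    vfieldInChart X x (extChartAt (𝓡 4) x x) = X x := by
  have h := chartPush_vfieldInChart X x (mem_extChartAt_target (I := 𝓡 4) x)
  rw [chartPush_self] at h
  exact h.trans (eq_of_point_eq (T := E4) X (extChartAt_to_inv (I := 𝓡 4) x))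

theorem LorentzMetric.inChart_self (g : LorentzMetric M) (x : M) :
    g.inChart x (extChartAt (𝓡 4) x x) = g.val x := by
  rw [LorentzMetric.inChart, chartPush_self]
  exact eq_of_point_eq (T := E4 →L[ℝ] E4 →L[ℝ] ℝ) g.val (extChartAt_to_inv (I := 𝓡 4) x)

theorem compContinuousLinearMap_chartDeriv {k : ℕ} (x : M) (η : E4 [⋀^Fin k]→L[ℝ] ℝ) :
    η.compContinuousLinearMap (chartDeriv x) = η := by
  rw [chartDeriv_eq_id]; rfl

theorem extD_eq {k : ℕ} (η : DForm M k) (x : M) :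
    extD η x = extDeriv (formInChart η x) (extChartAt (𝓡 4) x x) := by
  exact compContinuousLinearMap_chartDeriv x _

theorem LorentzMetric.nabla_eq (g : LorentzMetric M) (Y : VField M) (x : M)
    (v : TangentSpace (𝓡 4) x) :
    g.nabla Y x v = covD (g.inChart x) (vfieldInChart Y x) (extChartAt (𝓡 4) x x) v := by
  have hinv : (chartDeriv x).inverse = ContinuousLinearMap.id ℝ E4 := by
    rw [chartDeriv_eq_id]; exact ContinuousLinearMap.inverse_id
  rw [LorentzMetric.nabla, hinv, chartDeriv_eq_id]
  rfl

theorem LorentzMetric.current_eq (g : LorentzMetric M) (F : DForm M 2) (x : M) :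
    g.current F x = hodgeStar₃ (g.inChart x (extChartAt (𝓡 4) x x))
    (extDeriv (fun y => hodgeStar₂ (g.inChart x y) (formInChart F x y))
      (extChartAt (𝓡 4) x x)) := by
  exact compContinuousLinearMap_chartDeriv x _

theorem LorentzMetric.inChart_apply (g : LorentzMetric M) (X Y : VField M) (x : M) {y : E4}
    (hy : y ∈ (extChartAt (𝓡 4) x).target) :
    g.inChart x y (vfieldInChart X x y) (vfieldInChart Y x y) =
      g.val ((extChartAt (𝓡 4) x).symm y) (X ((extChartAt (𝓡 4) x).symm y))
        (Y ((extChartAt (𝓡 4) x).symm y)) := by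
  rw [← chartPush_vfieldInChart X x hy, ← chartPush_vfieldInChart Y x hy]
  rfl

theorem SmoothVFieldOn.contDiffAt {X : VField M} {U : Set M} (hX : SmoothVFieldOn X U)
    (hU : IsOpen U) {x : M} (hx : x ∈ U) :
    ContDiffAt ℝ ∞ (vfieldInChart X x) (extChartAt (𝓡 4) x x) := by
  have hV := (hX x hx).contMDiffAt (hU.mem_nhds hx)
  rw [← extChartAt_to_inv (I := 𝓡 4) x] at hV
  have hy := mem_extChartAt_target (I := 𝓡 4) x
  have hf : ContMDiffAt 𝓘(ℝ, E4) (𝓡 4) ∞ (extChartAt (𝓡 4) x).symm (extChartAt (𝓡 4) x x) :=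
    (contMDiffOn_extChartAt_symm x).contMDiffAt (extChartAt_target_mem_nhds x)
  have := ContMDiffAt.mpullback_vectorField_preimage (m := ∞) (n := ∞) hV hf
    (chartPush_isInvertible x hy) (by rfl)
  exact contMDiffAt_vectorSpace_iff_contDiffAt.1 this

end Spacetime

/-! ### A metric with a differentiable null frame is differentiable -/

/-- The linear map `ℝ⁴ → ℝ⁴` with columns `s, l, a, n`. -/
def frameMap (s l a n : E4) : E4 →L[ℝ] E4 :=
  (EuclideanSpace.proj 0 : E4 →L[ℝ] ℝ).smulRight s +
    (EuclideanSpace.proj 1 : E4 →L[ℝ] ℝ).smulRight l +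
    (EuclideanSpace.proj 2 : E4 →L[ℝ] ℝ).smulRight a +
    (EuclideanSpace.proj 3 : E4 →L[ℝ] ℝ).smulRight n

theorem frameMap_apply (s l a n c : E4) :
    frameMap s l a n c = c 0 • s + c 1 • l + c 2 • a + c 3 • n := by
  simp [frameMap]

theorem IsNullFrame.frameMap_isInvertible {B : E4 →L[ℝ] E4 →L[ℝ] ℝ} {s l a n : E4}
    (h : IsNullFrame B s l a n) : (frameMap s l a n).IsInvertible := by
  have hinj : Function.Injective (frameMap s l a n) := by
    rw [injective_iff_map_eq_zero]
    intro c hc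
    have := Fintype.linearIndependent_iff.1 h.linearIndependent c (by
      rw [Fin.sum_univ_four]; exact (frameMap_apply s l a n c).symm.trans hc)
    ext i
    exact this i
  refine ⟨(LinearEquiv.ofInjectiveEndo (frameMap s l a n).toLinearMap
    hinj).toContinuousLinearEquiv, ?_⟩
  ext v
  rfl

/-- The lowered legs of a null frame are the dual coframe, up to signs and order. -/
theorem IsNullFrame.flat_eq {B : E4 →L[ℝ] E4 →L[ℝ] ℝ} {s l a n : E4}
    (h : IsNullFrame B s l a n) (v : E4) :
    B s v = (frameMap s l a n).inverse v 0 ∧ B n v = -(frameMap s l a n).inverse v 1 ∧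
    B a v = (frameMap s l a n).inverse v 2 ∧ B l v = -(frameMap s l a n).inverse v 3 := by
  have hv := h.frameMap_isInvertible.self_apply_inverse v
  rw [frameMap_apply] at hv
  set c := (frameMap s l a n).inverse v
  refine ⟨?_, ?_, ?_, ?_⟩
  · conv_lhs => rw [← hv]
    simp [h.ss, h.sl, h.sa, h.sn]
  · conv_lhs => rw [← hv]
    simp [h.ns, h.nl, h.na, h.nn]
  · conv_lhs => rw [← hv]
    simp [h.as, h.al, h.aa, h.an]
  · conv_lhs => rw [← hv]
    simp [h.ls, h.ll, h.la, h.ln]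

set_option synthInstance.maxHeartbeats 200000 in
/-- The metric is a quadratic expression in the coframe dual to a null frame, and the dual coframe
is the inverse of the frame. -/
theorem differentiableAt_of_nullFrame {G : E4 → E4 →L[ℝ] E4 →L[ℝ] ℝ} {s l a n : E4 → E4} {y : E4}
    (hs : DifferentiableAt ℝ s y) (hl : DifferentiableAt ℝ l y) (ha : DifferentiableAt ℝ a y)
    (hn : DifferentiableAt ℝ n y)
    (h : ∀ᶠ z in 𝓝 y, IsNullFrame (G z) (s z) (l z) (a z) (n z)) : DifferentiableAt ℝ G y := by
  have hP : DifferentiableAt ℝ (fun z => frameMap (s z) (l z) (a z) (n z)) y := by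
    have e : ∀ (i : Fin 4) (f : E4 → E4), DifferentiableAt ℝ f y →
        DifferentiableAt ℝ (fun z => (EuclideanSpace.proj i : E4 →L[ℝ] ℝ).smulRight (f z)) y :=
      fun i f hf => (ContinuousLinearMap.smulRightL ℝ E4 E4
        (EuclideanSpace.proj i : E4 →L[ℝ] ℝ)).differentiableAt.comp y hf
    exact (((e 0 s hs).add (e 1 l hl)).add (e 2 a ha)).add (e 3 n hn)
  have hQ : DifferentiableAt ℝ (fun z => (frameMap (s z) (l z) (a z) (n z)).inverse) y :=
    DifferentiableAt.comp (g := ContinuousLinearMap.inverse) y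
      ((h.self_of_nhds.frameMap_isInvertible.contDiffAt_map_inverse (n := 1)).differentiableAt
        (by simp)) hP
  have hq : ∀ i, DifferentiableAt ℝ (fun z => (EuclideanSpace.proj i : E4 →L[ℝ] ℝ) ∘L
      (frameMap (s z) (l z) (a z) (n z)).inverse) y := fun i =>
    (differentiableAt_const _).clm_comp hQ
  have hbil : IsBoundedBilinearMap ℝ fun p : (E4 →L[ℝ] ℝ) × (E4 →L[ℝ] ℝ) =>
      (p.1.smulRight p.2 : E4 →L[ℝ] E4 →L[ℝ] ℝ) := isBoundedBilinearMap_smulRight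
  have hqq : ∀ i j, DifferentiableAt ℝ (fun z => ((EuclideanSpace.proj i : E4 →L[ℝ] ℝ) ∘L
      (frameMap (s z) (l z) (a z) (n z)).inverse).smulRight ((EuclideanSpace.proj j : E4 →L[ℝ] ℝ) ∘L
      (frameMap (s z) (l z) (a z) (n z)).inverse)) y := fun i j =>
    DifferentiableAt.comp (g := fun p : (E4 →L[ℝ] ℝ) × (E4 →L[ℝ] ℝ) =>
      (p.1.smulRight p.2 : E4 →L[ℝ] E4 →L[ℝ] ℝ)) y (hbil.differentiableAt _)
      ((hq i).prodMk (hq j))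
  refine ((((hqq 0 0).add (hqq 2 2)).sub (hqq 1 3)).sub (hqq 3 1)).congr_of_eventuallyEq ?_
  filter_upwards [h] with z hz
  ext v w
  have hv := hz.flat_eq v
  have hw := hz.flat_eq w
  conv_lhs => rw [hz.expand w]
  simp only [map_sub, map_add, map_smul, smul_eq_mul]
  rw [hz.symm v (s z), hz.symm v (a z), hz.symm v (n z), hz.symm v (l z),
    hv.1, hv.2.1, hv.2.2.1, hv.2.2.2, hw.1, hw.2.1, hw.2.2.1, hw.2.2.2]
  change _ = (frameMap (s z) (l z) (a z) (n z)).inverse v 0 *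
    (frameMap (s z) (l z) (a z) (n z)).inverse w 0 +
    (frameMap (s z) (l z) (a z) (n z)).inverse v 2 *
    (frameMap (s z) (l z) (a z) (n z)).inverse w 2 -
    (frameMap (s z) (l z) (a z) (n z)).inverse v 1 *
    (frameMap (s z) (l z) (a z) (n z)).inverse w 3 -
    (frameMap (s z) (l z) (a z) (n z)).inverse v 3 *
    (frameMap (s z) (l z) (a z) (n z)).inverse w 1
  ring

/-! ### Adapted frames in charts -/

section Spacetime

variable {M : Type*} [TopologicalSpace M] [ChartedSpace E4 M] [IsManifold (𝓡 4) ∞ M]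
  {g : LorentzMetric M} {𝓕 : NullFoliation g} {U : Set M} {s l a n : VField M}

namespace IsAdaptedFrame

theorem isNullFrame (h : IsAdaptedFrame 𝓕 U s l a n) {x : M} (hx : x ∈ U) :
    IsNullFrame (g.val x) (s x) (l x) (a x) (n x) :=
  ⟨g.symm x, h.ss x hx, h.ll x hx, h.aa x hx, h.nn x hx, h.nl x hx, h.ls x hx, h.la x hx,
    h.sa x hx, h.ns x hx, h.na x hx⟩

theorem isNullFrameNear (h : IsAdaptedFrame 𝓕 U s l a n) (hU : IsOpen U) {x : M} (hx : x ∈ U) :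
    IsNullFrameNear (g.inChart x) (vfieldInChart s x) (vfieldInChart l x) (vfieldInChart a x)
      (vfieldInChart n x) (extChartAt (𝓡 4) x x) := by
  have hs := (h.smooth_s.contDiffAt hU hx).differentiableAt (by simp)
  have hl := (h.smooth_l.contDiffAt hU hx).differentiableAt (by simp)
  have ha := (h.smooth_a.contDiffAt hU hx).differentiableAt (by simp)
  have hn := (h.smooth_n.contDiffAt hU hx).differentiableAt (by simp)
  have hmem : ∀ᶠ y in 𝓝 (extChartAt (𝓡 4) x x), (extChartAt (𝓡 4) x).symm y ∈ U :=
    (continuousAt_extChartAt_symm x).eventually_mem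
      (by rw [extChartAt_to_inv]; exact hU.mem_nhds hx)
  have hframe : ∀ᶠ y in 𝓝 (extChartAt (𝓡 4) x x), IsNullFrame (g.inChart x y)
      (vfieldInChart s x y) (vfieldInChart l x y) (vfieldInChart a x y) (vfieldInChart n x y) := by
    filter_upwards [hmem, eventually_mem_target x] with y hy ht
    have := h.isNullFrame hy
    refine ⟨fun v w => g.symm _ _ _, ?_, ?_, ?_, ?_, ?_, ?_, ?_, ?_, ?_, ?_⟩ <;>
      rw [g.inChart_apply _ _ x ht]
    exacts [this.ss, this.ll, this.aa, this.nn, this.nl, this.ls, this.la, this.sa, this.ns,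
      this.na]
  exact ⟨differentiableAt_of_nullFrame hs hl ha hn hframe, hs, hl, ha, hn, hframe⟩

end IsAdaptedFrame

end Spacetime

/-! ### Forms `u dx³ ∧ dx⁴` in a chart -/

section Spacetime

variable {M : Type*} [TopologicalSpace M] [ChartedSpace E4 M]

/-- The two-form `u dx³ ∧ dx⁴` of a chart. -/
def coordForm (φ : OpenPartialHomeomorph M E4) (u : M → ℝ) : DForm M 2 := fun x =>
  u x • wedge₁ (dcoord φ 2 x) (dcoord φ 3 x)

/-- The differential of a chart, as a map of `ℝ⁴`. -/
def chartDiff (φ : OpenPartialHomeomorph M E4) (x : M) : TangentSpace (𝓡 4) x →L[ℝ] E4 :=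
  mfderiv (𝓡 4) 𝓘(ℝ, E4) φ x

theorem dcoord_apply (φ : OpenPartialHomeomorph M E4) (i : Fin 4) (x : M)
    (v : TangentSpace (𝓡 4) x) : dcoord φ i x v = chartDiff φ x v i := rfl

theorem coordForm_apply (φ : OpenPartialHomeomorph M E4) (u : M → ℝ) (x : M)
    (v w : TangentSpace (𝓡 4) x) : coordForm φ u x ![v, w] = u x *
      (chartDiff φ x v 2 * chartDiff φ x w 3 - chartDiff φ x w 2 * chartDiff φ x v 3) := rfl

variable {φ : OpenPartialHomeomorph M E4} (hφ : φ ∈ IsManifold.maximalAtlas (𝓡 4) ∞ M)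
  {x : M} (hx : x ∈ φ.source)

include hφ hx

theorem mdifferentiableAt_chart : MDifferentiableAt (𝓡 4) 𝓘(ℝ, E4) φ x :=
  (contMDiffAt_of_mem_maximalAtlas hφ hx).mdifferentiableAt (by simp)

theorem chartDiff_isInvertible : (chartDiff φ x).IsInvertible := by
  have hd : φ.MDifferentiable (𝓡 4) 𝓘(ℝ, E4) :=
    ⟨(contMDiffOn_of_mem_maximalAtlas hφ).mdifferentiableOn (by simp),
      (contMDiffOn_symm_of_mem_maximalAtlas hφ).mdifferentiableOn (by simp)⟩
  exact ⟨hd.mfderiv hx, rfl⟩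

theorem chartDiff_coordVec (i : Fin 4) : chartDiff φ x (coordVec φ i x) = stdVec i :=
  (chartDiff_isInvertible hφ hx).self_apply_inverse _

theorem sum_coordVec (v : TangentSpace (𝓡 4) x) :
    ∑ i, chartDiff φ x v i • coordVec φ i x = v := by
  apply (chartDiff_isInvertible hφ hx).injective
  rw [map_sum]
  simp only [map_smul, chartDiff_coordVec hφ hx, sum_coord_smul_stdVec]

omit hφ in
theorem eventually_mem_source :
    ∀ᶠ y in 𝓝 (extChartAt (𝓡 4) x x), (extChartAt (𝓡 4) x).symm y ∈ φ.source :=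
  (continuousAt_extChartAt_symm x).eventually_mem
    (by rw [extChartAt_to_inv]; exact φ.open_source.mem_nhds hx)

variable [IsManifold (𝓡 4) ∞ M]

/-- The coordinate change from the preferred chart at `x` to `φ` is smooth at the image of `x`. -/
theorem contDiffAt_transition :
    ContDiffAt ℝ ∞ (φ ∘ (extChartAt (𝓡 4) x).symm) (extChartAt (𝓡 4) x x) := by
  rw [← contMDiffAt_iff_contDiffAt]
  refine ContMDiffAt.comp_of_eq (contMDiffAt_of_mem_maximalAtlas hφ hx)
    ((contMDiffOn_extChartAt_symm x).contMDiffAt (extChartAt_target_mem_nhds x))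
    (extChartAt_to_inv x)

omit hx in
theorem fderiv_transition {y : E4} (hy : y ∈ (extChartAt (𝓡 4) x).target)
    (hy' : (extChartAt (𝓡 4) x).symm y ∈ φ.source) :
    fderiv ℝ (φ ∘ (extChartAt (𝓡 4) x).symm) y =
      chartDiff φ ((extChartAt (𝓡 4) x).symm y) ∘L chartPush x y := by
  rw [← mfderiv_eq_fderiv]
  have hs : MDifferentiableAt 𝓘(ℝ, E4) (𝓡 4) (extChartAt (𝓡 4) x).symm y :=
    ((contMDiffOn_extChartAt_symm (n := ∞) x).contMDiffAt
      ((isOpen_extChartAt_target x).mem_nhds hy)).mdifferentiableAt (by simp)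
  exact mfderiv_comp y (mdifferentiableAt_chart hφ hy') hs

theorem fderiv_transition_self :
    fderiv ℝ (φ ∘ (extChartAt (𝓡 4) x).symm) (extChartAt (𝓡 4) x x) = chartDiff φ x := by
  rw [fderiv_transition hφ (mem_extChartAt_target x) (by rwa [extChartAt_to_inv]), chartPush_self]
  exact eq_of_point_eq (T := E4 →L[ℝ] E4) (chartDiff φ) (extChartAt_to_inv (I := 𝓡 4) x)

/-- The differential of the coordinate function `x^i` of `φ`, in the preferred chart at `x`. -/
theorem eventually_fderiv_coord (i : Fin 4) :
    ∀ᶠ y in 𝓝 (extChartAt (𝓡 4) x x),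
      fderiv ℝ (fun z => φ ((extChartAt (𝓡 4) x).symm z) i) y =
        (dcoord φ i ((extChartAt (𝓡 4) x).symm y)) ∘L chartPush x y := by
  have hc := ((contDiffAt_transition hφ hx).of_le (m := 1)
    (by exact_mod_cast le_top)).eventually (by simp)
  filter_upwards [hc, eventually_mem_target x, eventually_mem_source hx] with y h1 h2 h3
  have hd : HasFDerivAt (φ ∘ (extChartAt (𝓡 4) x).symm) _ y :=
    (h1.differentiableAt (by simp)).hasFDerivAt
  rw [fderiv_transition hφ h2 h3] at hd
  exact ((EuclideanSpace.proj i : E4 →L[ℝ] ℝ).hasFDerivAt.comp y hd).fderiv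

theorem contDiffAt_coord (i : Fin 4) :
    ContDiffAt ℝ ∞ (fun z => φ ((extChartAt (𝓡 4) x).symm z) i) (extChartAt (𝓡 4) x x) :=
  (EuclideanSpace.proj i : E4 →L[ℝ] ℝ).contDiff.contDiffAt.comp _ (contDiffAt_transition hφ hx)

theorem formInChart_coordForm (u : M → ℝ) :
    ∀ᶠ y in 𝓝 (extChartAt (𝓡 4) x x), formInChart (coordForm φ u) x y =
      u ((extChartAt (𝓡 4) x).symm y) •
        wedge₁ (fderiv ℝ (fun z => φ ((extChartAt (𝓡 4) x).symm z) 2) y)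
          (fderiv ℝ (fun z => φ ((extChartAt (𝓡 4) x).symm z) 3) y) := by
  filter_upwards [eventually_fderiv_coord hφ hx 2, eventually_fderiv_coord hφ hx 3] with y h2 h3
  rw [h2, h3]
  rfl

theorem contDiffAt_wedge_coord : ContDiffAt ℝ ∞ (fun y =>
      wedge₁ (fderiv ℝ (fun z => φ ((extChartAt (𝓡 4) x).symm z) 2) y)
        (fderiv ℝ (fun z => φ ((extChartAt (𝓡 4) x).symm z) 3) y)) (extChartAt (𝓡 4) x x) :=
  ContDiffAt.comp (g := fun p : (E4 →L[ℝ] ℝ) × (E4 →L[ℝ] ℝ) => wedge₁ p.1 p.2) _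
    isBoundedBilinearMap_wedge₁.contDiff.contDiffAt
    (((contDiffAt_coord hφ hx 2).fderiv_right (m := ∞) (by rfl)).prodMk
      ((contDiffAt_coord hφ hx 3).fderiv_right (m := ∞) (by rfl)))

omit hφ hx in
theorem ContMDiffAt.contDiffAt_chart {u : M → ℝ} (hu : ContMDiffAt (𝓡 4) 𝓘(ℝ, ℝ) ∞ u x) :
    ContDiffAt ℝ ∞ (fun y => u ((extChartAt (𝓡 4) x).symm y)) (extChartAt (𝓡 4) x x) := by
  rw [← contMDiffAt_iff_contDiffAt]
  exact ContMDiffAt.comp_of_eq hu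
    ((contMDiffOn_extChartAt_symm x).contMDiffAt (extChartAt_target_mem_nhds x))
    (extChartAt_to_inv x)

theorem contDiffAt_coordForm {u : M → ℝ} (hu : ContMDiffAt (𝓡 4) 𝓘(ℝ, ℝ) ∞ u x) :
    ContDiffAt ℝ ∞ (formInChart (coordForm φ u) x) (extChartAt (𝓡 4) x x) :=
  (hu.contDiffAt_chart.smul (contDiffAt_wedge_coord hφ hx)).congr_of_eventuallyEq
    (formInChart_coordForm hφ hx u)

/-- A function `u` with `u dx³ ∧ dx⁴` smooth is smooth. -/
theorem contMDiffAt_of_contDiffAt_coordForm {u : M → ℝ}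
    (hF : ContDiffAt ℝ ∞ (formInChart (coordForm φ u) x) (extChartAt (𝓡 4) x x)) :
    ContMDiffAt (𝓡 4) 𝓘(ℝ, ℝ) ∞ u x := by
  set y₀ := extChartAt (𝓡 4) x x
  set c : Fin 2 → E4 := ![coordVec φ 2 x, coordVec φ 3 x]
  set δ : E4 → E4 [⋀^Fin 2]→L[ℝ] ℝ := fun y =>
      wedge₁ (fderiv ℝ (fun z => φ ((extChartAt (𝓡 4) x).symm z) 2) y)
        (fderiv ℝ (fun z => φ ((extChartAt (𝓡 4) x).symm z) 3) y)
  have hev : ∀ {η : E4 → E4 [⋀^Fin 2]→L[ℝ] ℝ}, ContDiffAt ℝ ∞ η y₀ →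
      ContDiffAt ℝ ∞ (fun y => η y c) y₀ := fun hη =>
    (ContinuousAlternatingMap.apply ℝ E4 ℝ c).contDiff.contDiffAt.comp _ hη
  have hδ := hev (contDiffAt_wedge_coord hφ hx)
  have hδ1 : δ y₀ c = 1 := by
    have h2 := (eventually_fderiv_coord hφ hx 2).self_of_nhds
    have h3 := (eventually_fderiv_coord hφ hx 3).self_of_nhds
    rw [chartPush_self] at h2 h3
    have e := fun i => eq_of_point_eq (T := E4 →L[ℝ] ℝ) (dcoord φ i)
      (extChartAt_to_inv (I := 𝓡 4) x)
    have h2' := h2.trans (e 2)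
    have h3' := h3.trans (e 3)
    have : δ y₀ = wedge₁ (dcoord φ 2 x) (dcoord φ 3 x) := by
      simp only [δ]; rw [h2', h3']; rfl
    rw [this]
    change wedge₁ (dcoord φ 2 x) (dcoord φ 3 x) ![coordVec φ 2 x, coordVec φ 3 x] = 1
    simp [dcoord_apply, chartDiff_coordVec hφ hx, stdVec]
  have hne : ∀ᶠ y in 𝓝 y₀, δ y c ≠ 0 :=
    hδ.continuousAt.eventually_ne (by rw [hδ1]; exact one_ne_zero)
  have hU : ContDiffAt ℝ ∞ (fun y => u ((extChartAt (𝓡 4) x).symm y)) y₀ := by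
    refine ((hev hF).div hδ (by rw [hδ1]; exact one_ne_zero)).congr_of_eventuallyEq ?_
    filter_upwards [formInChart_coordForm hφ hx u, hne] with y h1 h2
    change u _ = formInChart (coordForm φ u) x y c / δ y c
    rw [h1, ContinuousAlternatingMap.smul_apply, smul_eq_mul]
    exact (mul_div_cancel_right₀ _ h2).symm
  refine (hU.contMDiffAt.comp x (contMDiffAt_extChartAt (n := ∞))).congr_of_eventuallyEq ?_
  filter_upwards [extChartAt_source_mem_nhds (I := 𝓡 4) x] with z hz
  change u z = u ((extChartAt (𝓡 4) x).symm (extChartAt (𝓡 4) x z))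
  rw [(extChartAt (𝓡 4) x).left_inv hz]

/-- `u dx³ ∧ dx⁴` is closed exactly when `u` does not depend on `x¹` and `x²`. -/
theorem extD_coordForm_eq_zero_iff {u : M → ℝ} (hu : ContMDiffAt (𝓡 4) 𝓘(ℝ, ℝ) ∞ u x) :
    extD (coordForm φ u) x = 0 ↔
      fderiv ℝ (u ∘ φ.symm) (φ x) (stdVec 0) = 0 ∧ fderiv ℝ (u ∘ φ.symm) (φ x) (stdVec 1) = 0 := by
  set y₀ := extChartAt (𝓡 4) x x
  obtain ⟨D, hD⟩ : ∃ D : E4 →L[ℝ] E4, D = chartDiff φ x := ⟨_, rfl⟩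
  have hDc : ∀ i, D (coordVec φ i x) = stdVec i := by
    rw [hD]; exact chartDiff_coordVec hφ hx
  set V := fderiv ℝ (u ∘ φ.symm) (φ x)
  have hy₀ : (extChartAt (𝓡 4) x).symm y₀ = x := extChartAt_to_inv x
  have hp := fun i => (contDiffAt_coord hφ hx i).fderiv_right (m := ∞) (by rfl)
  have hp' := fun i => ((hp i).differentiableAt (by simp)).hasFDerivAt
  have hpi : ∀ i v, fderiv ℝ (fun z => φ ((extChartAt (𝓡 4) x).symm z) i) y₀ v = D v i := by
    intro i v
    have h := (eventually_fderiv_coord hφ hx i).self_of_nhds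
    rw [chartPush_self] at h
    have h' := h.trans (eq_of_point_eq (T := E4 →L[ℝ] ℝ) (dcoord φ i) hy₀)
    rw [h', hD]
    rfl
  have hsym : ∀ i v w, fderiv ℝ (fderiv ℝ fun z => φ ((extChartAt (𝓡 4) x).symm z) i) y₀ v w =
      fderiv ℝ (fderiv ℝ fun z => φ ((extChartAt (𝓡 4) x).symm z) i) y₀ w v := fun i v w =>
    ((contDiffAt_coord hφ hx i).isSymmSndFDerivAt (by simpa using ENat.LEInfty.out)) v w
  have hV : HasFDerivAt (u ∘ φ.symm) V (φ x) := by
    have : ContMDiffAt 𝓘(ℝ, E4) 𝓘(ℝ, ℝ) ∞ (u ∘ φ.symm) (φ x) :=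
      ContMDiffAt.comp_of_eq hu
        (contMDiffAt_symm_of_mem_maximalAtlas hφ (φ.map_source hx)) (φ.left_inv hx)
    exact (this.contDiffAt.differentiableAt (by simp)).hasFDerivAt
  have hU : HasFDerivAt (fun y => u ((extChartAt (𝓡 4) x).symm y)) (V ∘L D) y₀ := by
    have h1 : HasFDerivAt (φ ∘ (extChartAt (𝓡 4) x).symm) D y₀ := by
      have := ((contDiffAt_transition hφ hx).differentiableAt (by simp)).hasFDerivAt
      rwa [fderiv_transition_self hφ hx, ← hD] at this
    have h2 : φ ((extChartAt (𝓡 4) x).symm y₀) = φ x := by rw [hy₀]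
    refine (HasFDerivAt.comp y₀ (by rw [Function.comp_apply, h2]; exact hV)
      h1).congr_of_eventuallyEq ?_
    filter_upwards [eventually_mem_source hx] with y hy
    change u _ = u (φ.symm (φ _))
    rw [φ.left_inv hy]
  have hext : extD (coordForm φ u) x = extDeriv (fun y => u ((extChartAt (𝓡 4) x).symm y) •
        wedge₁ (fderiv ℝ (fun z => φ ((extChartAt (𝓡 4) x).symm z) 2) y)
          (fderiv ℝ (fun z => φ ((extChartAt (𝓡 4) x).symm z) 3) y)) y₀ :=
    (extD_eq _ _).trans (Filter.EventuallyEq.extDeriv_eq (formInChart_coordForm hφ hx u))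
  rw [hext]
  have hform := fun X Y Z : E4 => extDeriv_smul_wedge₁ hU (hp' 2) (hp' 3) X Y Z
  change extDeriv (E := E4) _ y₀ = 0 ↔ _
  set η := extDeriv (fun y => u ((extChartAt (𝓡 4) x).symm y) •
        wedge₁ (fderiv ℝ (fun z => φ ((extChartAt (𝓡 4) x).symm z) 2) y)
          (fderiv ℝ (fun z => φ ((extChartAt (𝓡 4) x).symm z) 3) y)) y₀
  replace hform : ∀ X Y Z : E4, η ![X, Y, Z] =
      V (D X) * (D Y 2 * D Z 3 - D Z 2 * D Y 3) - V (D Y) * (D X 2 * D Z 3 - D Z 2 * D X 3) +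
      V (D Z) * (D X 2 * D Y 3 - D Y 2 * D X 3) := by
    intro X Y Z
    rw [hform]
    simp only [hpi]
    rw [hsym 2 Y X, hsym 2 Z X, hsym 2 Z Y, hsym 3 Y X, hsym 3 Z X, hsym 3 Z Y]
    simp only [ContinuousLinearMap.comp_apply]
    ring
  constructor
  · intro h
    have key : ∀ i : Fin 4, i ≠ 2 → i ≠ 3 → V (stdVec i) = 0 := by
      intro i h2 h3
      have := hform (coordVec φ i x) (coordVec φ 2 x) (coordVec φ 3 x)
      rw [h, hDc, hDc, hDc] at this
      simpa [stdVec, h2.symm, h3.symm] using this.symm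
    exact ⟨key 0 (by decide) (by decide), key 1 (by decide) (by decide)⟩
  · rintro ⟨h0, h1⟩
    have hVD : ∀ v : E4, V (D v) = D v 2 * V (stdVec 2) + D v 3 * V (stdVec 3) := by
      intro v
      rw [← sum_coord_mul V (D v), Fin.sum_univ_four, h0, h1]
      ring
    ext v
    have hv : v = ![v 0, v 1, v 2] := by ext i; fin_cases i <;> rfl
    rw [hv, hform, hVD, hVD, hVD, ContinuousAlternatingMap.coe_zero, Pi.zero_apply]
    ring

end Spacetime

/-! ### Functions on the leaf space -/

/-- The linear projection of `ℝ⁴` onto the plane of the first two coordinates. -/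
def planeProj : E4 →L[ℝ] E4 :=
  (EuclideanSpace.proj 0 : E4 →L[ℝ] ℝ).smulRight (stdVec 0) +
    (EuclideanSpace.proj 1 : E4 →L[ℝ] ℝ).smulRight (stdVec 1)

theorem planeProj_apply (v : E4) : planeProj v = v 0 • stdVec 0 + v 1 • stdVec 1 := rfl

theorem planeProj_add (y : E4) : planeProj y + (y 2 • stdVec 2 + y 3 • stdVec 3) = y := by
  conv_rhs => rw [← sum_coord_smul_stdVec y, Fin.sum_univ_four]
  rw [planeProj_apply]
  abel

/-- A function on an open set of `ℝ⁴` whose derivatives along the first two coordinates vanish is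
constant on each connected slice on which the last two coordinates are constant. -/
theorem eq_of_fderiv_eq_zero_on_slice {V : E4 → ℝ} {Ω : Set E4} (hΩ : IsOpen Ω)
    (hV : ∀ y ∈ Ω, DifferentiableAt ℝ V y)
    (h0 : ∀ y ∈ Ω, fderiv ℝ V y (stdVec 0) = 0 ∧ fderiv ℝ V y (stdVec 1) = 0) (c d : ℝ)
    (hS : IsPreconnected {y : E4 | y ∈ Ω ∧ y 2 = c ∧ y 3 = d}) {y z : E4} (hy : y ∈ Ω)
    (hz : z ∈ Ω) (hyc : y 2 = c) (hyd : y 3 = d) (hzc : z 2 = c) (hzd : z 3 = d) : V y = V z := by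
  -- Pulled back along the projection of `ℝ⁴` onto the plane of the slice, `V` becomes a function
  -- with vanishing derivative on a connected open set.
  set b : E4 := c • stdVec 2 + d • stdVec 3
  set C : Set E4 := {v | planeProj v + b ∈ Ω}
  have hb : ∀ x : E4, x 2 = c → x 3 = d → planeProj x + b = x := by
    rintro x rfl rfl; exact planeProj_add x
  have hb2 : ∀ v : E4, (planeProj v + b) 2 = c ∧ (planeProj v + b) 3 = d := by
    intro v; simp [planeProj_apply, b, stdVec]
  have hb0 : planeProj b = 0 := by simp [planeProj_apply, b, stdVec]
  have hpp : ∀ v, planeProj (planeProj v) = planeProj v := by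
    intro v; simp [planeProj_apply, stdVec]
  have hCo : IsOpen C := hΩ.preimage (by fun_prop)
  have hCp : IsPreconnected C := by
    have himg : C = (fun q : E4 × E4 => q.1 + (q.2 - planeProj q.2)) ''
        ({y : E4 | y ∈ Ω ∧ y 2 = c ∧ y 3 = d} ×ˢ Set.univ) := by
      ext v
      constructor
      · intro hv
        refine ⟨(planeProj v + b, v - b), ⟨⟨hv, hb2 v⟩, trivial⟩, ?_⟩
        simp only [map_sub, hb0]
        abel
      · rintro ⟨⟨q, t⟩, ⟨⟨hq, hq2, hq3⟩, -⟩, rfl⟩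
        change planeProj (q + (t - planeProj t)) + b ∈ Ω
        rw [map_add, map_sub, hpp, sub_self, add_zero, hb q hq2 hq3]
        exact hq
    rw [himg]
    exact (hS.prod isPreconnected_univ).image _ (by fun_prop)
  have hW : ∀ v ∈ C, HasFDerivAt (fun v => V (planeProj v + b)) (0 : E4 →L[ℝ] ℝ) v := by
    intro v hv
    have h1 : HasFDerivAt (fun v => planeProj v + b) planeProj v :=
      planeProj.hasFDerivAt.add_const b
    have h2 := (hV _ hv).hasFDerivAt.comp v h1
    have h3 : (fderiv ℝ V (planeProj v + b)).comp planeProj = 0 := by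
      ext w
      change fderiv ℝ V (planeProj v + b) (planeProj w) = 0
      rw [planeProj_apply w, map_add, map_smul, map_smul, (h0 _ hv).1, (h0 _ hv).2]
      simp
    rwa [h3] at h2
  have hconst := hCo.is_const_of_fderiv_eq_zero hCp
    (fun v hv => (hW v hv).differentiableAt.differentiableWithinAt) (fun v hv => (hW v hv).fderiv)
    (x := y) (y := z) (by change planeProj y + b ∈ Ω; rwa [hb y hyc hyd])
    (by change planeProj z + b ∈ Ω; rwa [hb z hzc hzd])
  simpa only [hb y hyc hyd, hb z hzc hzd] using hconst

section Spacetime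

variable {M : Type*} [TopologicalSpace M] [ChartedSpace E4 M]

theorem IsLeafFunction.contMDiffAt {φ : OpenPartialHomeomorph M E4} {u : M → ℝ}
    (hu : IsLeafFunction φ u) {x : M} (hx : x ∈ φ.source) :
    ContMDiffAt (𝓡 4) 𝓘(ℝ, ℝ) ∞ u x :=
  (hu.1 x hx).contMDiffAt (φ.open_source.mem_nhds hx)

theorem isLeafFunction_const (φ : OpenPartialHomeomorph M E4) (c : ℝ) :
    IsLeafFunction φ fun _ => c :=
  ⟨contMDiffOn_const, fun _ _ _ _ _ _ => rfl⟩

theorem contDiffAt_comp_symm {φ : OpenPartialHomeomorph M E4}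
    (hφ : φ ∈ IsManifold.maximalAtlas (𝓡 4) ∞ M) {u : M → ℝ} {y : E4} (hy : y ∈ φ.target)
    (hu : ContMDiffAt (𝓡 4) 𝓘(ℝ, ℝ) ∞ u (φ.symm y)) : ContDiffAt ℝ ∞ (u ∘ φ.symm) y := by
  rw [← contMDiffAt_iff_contDiffAt]
  exact hu.comp y (contMDiffAt_symm_of_mem_maximalAtlas hφ hy)

variable [IsManifold (𝓡 4) ∞ M]

/-- `u dx³ ∧ dx⁴` is closed if `u` is a function on the leaf space. -/
theorem IsLeafFunction.extD_coordForm {φ : OpenPartialHomeomorph M E4} {u : M → ℝ}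
    (hu : IsLeafFunction φ u) (hφ : φ ∈ IsManifold.maximalAtlas (𝓡 4) ∞ M) {x : M}
    (hx : x ∈ φ.source) : extD (coordForm φ u) x = 0 := by
  rw [extD_coordForm_eq_zero_iff hφ hx (hu.contMDiffAt hx)]
  have hV : HasFDerivAt (u ∘ φ.symm) (fderiv ℝ (u ∘ φ.symm) (φ x)) (φ x) :=
    ((contDiffAt_comp_symm hφ (φ.map_source hx)
      (by rw [φ.left_inv hx]; exact hu.contMDiffAt hx)).differentiableAt (by simp)).hasFDerivAt
  have key : ∀ i : Fin 4, i ≠ 2 → i ≠ 3 → fderiv ℝ (u ∘ φ.symm) (φ x) (stdVec i) = 0 := by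
    intro i h2 h3
    have hline : HasDerivAt (fun t : ℝ => φ x + t • stdVec i) (stdVec i) 0 := by
      simpa using ((hasDerivAt_id (0 : ℝ)).smul_const (stdVec i)).const_add (φ x)
    have h1 : HasDerivAt (fun t : ℝ => (u ∘ φ.symm) (φ x + t • stdVec i)) _ 0 :=
      HasFDerivAt.comp_hasDerivAt (l := u ∘ φ.symm) (f := fun t : ℝ => φ x + t • stdVec i)
        (0 : ℝ) (by simpa using hV) hline
    have hmem : ∀ᶠ t in 𝓝 (0 : ℝ), φ x + t • stdVec i ∈ φ.target :=
      hline.continuousAt.eventually_mem (by simpa using φ.open_target.mem_nhds (φ.map_source hx))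
    refine h1.unique ((hasDerivAt_const (0 : ℝ) (u x)).congr_of_eventuallyEq ?_)
    filter_upwards [hmem] with t ht
    refine hu.2 _ (φ.map_target ht) x hx ?_ ?_ <;> rw [φ.right_inv ht] <;>
      simp [stdVec, h2.symm, h3.symm]
  exact ⟨key 0 (by decide) (by decide), key 1 (by decide) (by decide)⟩

/-- If `u dx³ ∧ dx⁴` is smooth and closed and the slices are connected, `u` is a function on the leaf
space. -/
theorem isLeafFunction_of_closed {φ : OpenPartialHomeomorph M E4}
    (hφ : φ ∈ IsManifold.maximalAtlas (𝓡 4) ∞ M)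
    (hconn : ∀ c d : ℝ, IsPreconnected {y : E4 | y ∈ φ.target ∧ y 2 = c ∧ y 3 = d}) {u : M → ℝ}
    (hsm : ∀ x ∈ φ.source, ContMDiffAt (𝓡 4) 𝓘(ℝ, ℝ) ∞ u x)
    (hcl : ∀ x ∈ φ.source, extD (coordForm φ u) x = 0) : IsLeafFunction φ u := by
  refine ⟨fun x hx => (hsm x hx).contMDiffWithinAt, fun x hx y hy h2 h3 => ?_⟩
  have h := eq_of_fderiv_eq_zero_on_slice (V := u ∘ φ.symm) φ.open_target
    (fun z hz => (contDiffAt_comp_symm hφ hz (hsm _ (φ.map_target hz))).differentiableAt (by simp))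
    (fun z hz => by
      have := (extD_coordForm_eq_zero_iff hφ (φ.map_target hz) (hsm _ (φ.map_target hz))).1
        (hcl _ (φ.map_target hz))
      rwa [φ.right_inv hz] at this)
    (φ x 2) (φ x 3) (hconn _ _) (φ.map_source hx) (φ.map_source hy) rfl rfl h2.symm h3.symm
  simpa [φ.left_inv hx, φ.left_inv hy] using h

/-! ### The forms `F_u` and their kernels -/

variable {g : LorentzMetric M} {𝓕 : NullFoliation g} {φ : OpenPartialHomeomorph M E4}
  {s l a n : VField M}

theorem mem_tangent_iff (hT : TangentToSlices 𝓕.tangent φ) {x : M} (hx : x ∈ φ.source)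
    (v : TangentSpace (𝓡 4) x) :
    v ∈ 𝓕.tangent x ↔ chartDiff φ x v 2 = 0 ∧ chartDiff φ x v 3 = 0 := hT x hx v

theorem coordVec_mem_tangent (hφ : φ ∈ IsManifold.maximalAtlas (𝓡 4) ∞ M)
    (hT : TangentToSlices 𝓕.tangent φ) {x : M} (hx : x ∈ φ.source) {i : Fin 4} (h2 : i ≠ 2)
    (h3 : i ≠ 3) : coordVec φ i x ∈ 𝓕.tangent x := by
  rw [mem_tangent_iff hT hx, chartDiff_coordVec hφ hx]
  simp [stdVec, h2.symm, h3.symm]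

theorem formKer_coordForm (hφ : φ ∈ IsManifold.maximalAtlas (𝓡 4) ∞ M)
    (hT : TangentToSlices 𝓕.tangent φ) {x : M} (hx : x ∈ φ.source) {u : M → ℝ} (hu : u x ≠ 0) :
    formKer (coordForm φ u) x = 𝓕.tangent x := by
  ext v
  rw [SetLike.mem_coe, mem_tangent_iff hT hx]
  constructor
  · intro h
    have h2 := h (coordVec φ 2 x)
    have h3 := h (coordVec φ 3 x)
    rw [coordForm_apply, chartDiff_coordVec hφ hx] at h2 h3
    simpa [stdVec, hu, and_comm] using And.intro h2 h3
  · rintro ⟨h2, h3⟩ w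
    rw [coordForm_apply, h2, h3]
    ring

/-- A two-form whose kernel contains `∂₁` and `∂₂` is a multiple of `dx³ ∧ dx⁴`. -/
theorem eq_coordForm_of_formKer (hφ : φ ∈ IsManifold.maximalAtlas (𝓡 4) ∞ M)
    (hT : TangentToSlices 𝓕.tangent φ) {x : M} (hx : x ∈ φ.source) {F : DForm M 2}
    (hF : formKer F x = 𝓕.tangent x) :
    F x = coordForm φ (fun x => F x ![coordVec φ 2 x, coordVec φ 3 x]) x := by
  have h0 : ∀ i : Fin 4, i ≠ 2 → i ≠ 3 → ∀ w, F x ![coordVec φ i x, w] = 0 := by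
    intro i h2 h3 w
    have : coordVec φ i x ∈ formKer F x := by
      rw [hF]; exact coordVec_mem_tangent hφ hT hx h2 h3
    exact this w
  have hr : ∀ i : Fin 4, i ≠ 2 → i ≠ 3 → ∀ w, F x ![w, coordVec φ i x] = 0 := by
    intro i h2 h3 w
    rw [altForm₂_swap, h0 i h2 h3, neg_zero]
  have e1 : ∀ v w, F x ![v, w] = chartDiff φ x v 2 * F x ![coordVec φ 2 x, w] +
      chartDiff φ x v 3 * F x ![coordVec φ 3 x, w] := by
    intro v w
    conv_lhs => rw [← sum_coordVec hφ hx v]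
    have := map_sum (IsLinearMap.mk' _ (isLinearMap_altForm₂_fst (F x) w))
      (fun i => chartDiff φ x v i • coordVec φ i x) Finset.univ
    simp only [map_smul, IsLinearMap.mk'_apply, smul_eq_mul] at this
    rw [this, Fin.sum_univ_four, h0 0 (by decide) (by decide), h0 1 (by decide) (by decide)]
    ring
  have e2 : ∀ v w, F x ![v, w] = chartDiff φ x w 2 * F x ![v, coordVec φ 2 x] +
      chartDiff φ x w 3 * F x ![v, coordVec φ 3 x] := by
    intro v w
    rw [altForm₂_swap, e1, altForm₂_swap (F x) v, altForm₂_swap (F x) v]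
    ring
  ext v
  have hv : v = ![v 0, v 1] := by ext i; fin_cases i <;> rfl
  rw [hv, coordForm_apply, e1, e2 (coordVec φ 2 x), e2 (coordVec φ 3 x), altForm₂_self, altForm₂_self,
    altForm₂_swap (F x) (coordVec φ 2 x)]
  ring

theorem IsAdaptedFrame.flat_eq_zero (hframe : IsAdaptedFrame 𝓕 φ.source s l a n) {x : M}
    (hx : x ∈ φ.source) {v : TangentSpace (𝓡 4) x} (hv : v ∈ 𝓕.tangent x) :
    g.flat a x v = 0 ∧ g.flat l x v = 0 := by
  rw [← hframe.span x hx, Submodule.mem_span_pair] at hv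
  obtain ⟨c, d, rfl⟩ := hv
  have h1 : g.val x (a x) (s x) = 0 := (hframe.isNullFrame hx).as
  have h2 : g.val x (a x) (l x) = 0 := (hframe.isNullFrame hx).al
  simp [LorentzMetric.flat, h1, h2, hframe.ls x hx, hframe.ll x hx]

/-- `α ∧ l♭ = κ⁻¹ dx³ ∧ dx⁴`, because `α` and `l♭` annihilate the leaves. -/
theorem wedge_flat_eq (hφ : φ ∈ IsManifold.maximalAtlas (𝓡 4) ∞ M)
    (hT : TangentToSlices 𝓕.tangent φ) (hframe : IsAdaptedFrame 𝓕 φ.source s l a n) {x : M}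
    (hx : x ∈ φ.source) (v w : TangentSpace (𝓡 4) x) :
    wedge₁ (g.flat a x) (g.flat l x) ![v, w] = (kappa g φ l a x)⁻¹ *
      (chartDiff φ x v 2 * chartDiff φ x w 3 - chartDiff φ x w 2 * chartDiff φ x v 3) := by
  have hexp : ∀ ξ : TangentSpace (𝓡 4) x →L[ℝ] ℝ, (∀ v ∈ 𝓕.tangent x, ξ v = 0) → ∀ v,
      ξ v = chartDiff φ x v 2 * ξ (coordVec φ 2 x) + chartDiff φ x v 3 * ξ (coordVec φ 3 x) := by
    intro ξ hξ v
    conv_lhs => rw [← sum_coordVec hφ hx v]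
    rw [map_sum, Fin.sum_univ_four]
    simp only [map_smul, smul_eq_mul]
    rw [hξ _ (coordVec_mem_tangent hφ hT hx (i := 0) (by decide) (by decide)),
      hξ _ (coordVec_mem_tangent hφ hT hx (i := 1) (by decide) (by decide))]
    ring
  have ha := hexp (g.flat a x) fun v hv => (hframe.flat_eq_zero hx hv).1
  have hl := hexp (g.flat l x) fun v hv => (hframe.flat_eq_zero hx hv).2
  rw [wedge₁_apply, ha v, ha w, hl v, hl w, kappa, inv_inv]
  ring

/-- The denominator in `κ` does not vanish, as `(α ∧ l♭)(α♯, n) = -1`. -/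
theorem kappa_ne_zero (hφ : φ ∈ IsManifold.maximalAtlas (𝓡 4) ∞ M)
    (hT : TangentToSlices 𝓕.tangent φ) (hframe : IsAdaptedFrame 𝓕 φ.source s l a n) {x : M}
    (hx : x ∈ φ.source) : kappa g φ l a x ≠ 0 := by
  intro h0
  have h := wedge_flat_eq hφ hT hframe hx (a x) (n x)
  have h1 : g.val x (l x) (n x) = -1 := (hframe.isNullFrame hx).ln
  rw [h0, inv_zero, zero_mul, wedge₁_apply] at h
  simp only [LorentzMetric.flat] at h
  rw [hframe.aa x hx, hframe.la x hx, h1] at h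
  norm_num at h

theorem fieldForm_eq_coordForm (hφ : φ ∈ IsManifold.maximalAtlas (𝓡 4) ∞ M)
    (hT : TangentToSlices 𝓕.tangent φ) (hframe : IsAdaptedFrame 𝓕 φ.source s l a n) {x : M}
    (hx : x ∈ φ.source) (u : M → ℝ) : fieldForm g φ l a u x = coordForm φ u x := by
  have hκ := kappa_ne_zero hφ hT hframe hx
  ext v
  have hv : v = ![v 0, v 1] := by ext i; fin_cases i <;> rfl
  rw [hv, coordForm_apply, fieldForm, ContinuousAlternatingMap.smul_apply,
    wedge_flat_eq hφ hT hframe hx, smul_eq_mul]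
  field_simp

/-- `∇l` has no component along `n`, because `l` is null. -/
theorem IsAdaptedFrame.val_nabla_self (hframe : IsAdaptedFrame 𝓕 φ.source s l a n) {x : M}
    (hx : x ∈ φ.source) (v : TangentSpace (𝓡 4) x) : g.val x (g.nabla l x v) (l x) = 0 := by
  have h := (hframe.isNullFrameNear φ.open_source hx).covD_self v
  rw [vfieldInChart_self, g.inChart_self] at h
  rw [g.nabla_eq]
  exact h

end Spacetime

/-! ### The force-free condition at a point -/

section Spacetime

variable {M : Type*} [TopologicalSpace M] [ChartedSpace E4 M] {φ : OpenPartialHomeomorph M E4}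
  {x : M}

theorem formInChart_eventuallyEq {k : ℕ} {η η' : DForm M k} (h : ∀ x ∈ φ.source, η x = η' x)
    (hx : x ∈ φ.source) :
    formInChart η x =ᶠ[𝓝 (extChartAt (𝓡 4) x x)] formInChart η' x := by
  filter_upwards [eventually_mem_source hx] with y hy
  rw [formInChart, formInChart, h _ hy]

variable [IsManifold (𝓡 4) ∞ M] {g : LorentzMetric M} {𝓕 : NullFoliation g} {s l a n : VField M}

theorem LorentzMetric.val_nabla (g : LorentzMetric M) (Y : VField M) (x : M)
    (v z : TangentSpace (𝓡 4) x) :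
    g.val x (g.nabla Y x v) z = g.inChart x (extChartAt (𝓡 4) x x)
      (covD (g.inChart x) (vfieldInChart Y x) (extChartAt (𝓡 4) x x) v) z := by
  rw [g.nabla_eq, g.inChart_self]
  rfl

theorem LorentzMetric.nabla_combination (g : LorentzMetric M) (Y : VField M) (x : M) (c d : ℝ)
    (v w : TangentSpace (𝓡 4) x) :
    g.nabla Y x (c • v + d • w) = c • g.nabla Y x v + d • g.nabla Y x w := by
  rw [g.nabla_eq, g.nabla_eq, g.nabla_eq]
  exact covD_combination _ _ _ c d v w

theorem formInChart_fieldForm (g : LorentzMetric M) (φ : OpenPartialHomeomorph M E4)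
    (l a : VField M) (u : M → ℝ) (x : M) : ∀ᶠ y in 𝓝 (extChartAt (𝓡 4) x x),
      formInChart (fieldForm g φ l a u) x y =
        (u ((extChartAt (𝓡 4) x).symm y) * kappa g φ l a ((extChartAt (𝓡 4) x).symm y)) •
          wedge₁ (g.inChart x y (vfieldInChart a x y)) (g.inChart x y (vfieldInChart l x y)) := by
  filter_upwards [eventually_mem_target x] with y hy
  have e : ∀ X : VField M, g.inChart x y (vfieldInChart X x y) =
      g.flat X ((extChartAt (𝓡 4) x).symm y) ∘L chartPush x y := by
    intro X
    rw [LorentzMetric.flat, ← chartPush_vfieldInChart X x hy]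
    rfl
  rw [e, e]
  rfl

/-- Pairing a vector with `j♯` is evaluating the current `j`. -/
theorem IsAdaptedFrame.val_currentVec (hframe : IsAdaptedFrame 𝓕 φ.source s l a n)
    (hx : x ∈ φ.source) (F : DForm M 2) (v : TangentSpace (𝓡 4) x) :
    g.val x v (g.currentVec F x) = hodgeStar₃ (g.inChart x (extChartAt (𝓡 4) x x))
      (extDeriv (fun y => hodgeStar₂ (g.inChart x y) (formInChart F x y))
        (extChartAt (𝓡 4) x x)) ![v] := by
  have h := (hframe.isNullFrame hx).apply_sharpB
    ((ContinuousAlternatingMap.ofSubsingleton ℝ (TangentSpace (𝓡 4) x) ℝ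
      (0 : Fin 1)).symm (g.current F x))
  have h' := congrArg (fun ξ : E4 →L[ℝ] ℝ => ξ v) h
  rw [g.symm]
  refine h'.trans ?_
  rw [← g.current_eq F x]
  change g.current F x _ = g.current F x _
  congr 1
  ext i
  fin_cases i
  rfl

/-- The force-free condition for `F_u` at a point, in terms of the frame components of `∇l`. The
first part comes from `dF_u = 0` alone. -/
theorem fieldForm_forceFree_iff (hφ : φ ∈ IsManifold.maximalAtlas (𝓡 4) ∞ M)
    (hT : TangentToSlices 𝓕.tangent φ) (hframe : IsAdaptedFrame 𝓕 φ.source s l a n)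
    (hx : x ∈ φ.source) {u : M → ℝ} (hu : IsLeafFunction φ u) :
    (u x ≠ 0 → g.val x (g.nabla l x (l x)) (s x) = 0) ∧
    ((∀ v, fieldForm g φ l a u x ![g.currentVec (fieldForm g φ l a u) x, v] = 0) ↔
      (u x ≠ 0 → g.val x (g.nabla l x (l x)) (a x) = 0 ∧
        g.val x (g.nabla l x (s x)) (s x) = g.val x (g.nabla l x (a x)) (a x))) := by
  set y₀ := extChartAt (𝓡 4) x x
  set F := fieldForm g φ l a u
  have hF := formInChart_fieldForm g φ l a u x
  have hFu := formInChart_eventuallyEq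
    (fun x hx => fieldForm_eq_coordForm hφ hT hframe hx u) hx
  have hnear := hframe.isNullFrameNear φ.open_source hx
  have hκ : kappa g φ l a x ≠ 0 := kappa_ne_zero hφ hT hframe hx
  set w : E4 → ℝ := fun y =>
    u ((extChartAt (𝓡 4) x).symm y) * kappa g φ l a ((extChartAt (𝓡 4) x).symm y)
  have hw0 : w y₀ = u x * kappa g φ l a x := by
    simp only [w, y₀, extChartAt_to_inv]
  have hw : DifferentiableAt ℝ w y₀ := by
    -- The coefficient is recovered by evaluating the smooth form `u dx³ ∧ dx⁴` on `n, a`.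
    have hd := fun i => ((contDiffAt_coord hφ hx i).fderiv_right (m := ∞)
      (by rfl)).differentiableAt (by simp)
    have hU := (hu.contMDiffAt hx).contDiffAt_chart.differentiableAt (by simp)
    refine (hU.mul ((((hd 2).clm_apply hnear.diff_n).mul ((hd 3).clm_apply hnear.diff_a)).sub
      (((hd 2).clm_apply hnear.diff_a).mul ((hd 3).clm_apply
        hnear.diff_n)))).congr_of_eventuallyEq ?_
    filter_upwards [hF, hFu, formInChart_coordForm hφ hx u, hnear.frame] with y h1 h2 h3 h4
    have h5 := congrArg (fun η : E4 [⋀^Fin 2]→L[ℝ] ℝ =>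
      η ![vfieldInChart n x y, vfieldInChart a x y]) (h1.symm.trans (h2.trans h3))
    simp only [ContinuousAlternatingMap.smul_apply, wedge₁_apply, smul_eq_mul, h4.an, h4.ln,
      h4.aa, h4.la] at h5
    simp only [w, Pi.mul_apply, Pi.sub_apply]
    linear_combination h5
  have hcl : extDeriv (formInChart F x) y₀ = 0 := by
    rw [hFu.extDeriv_eq, ← extD_eq]
    exact hu.extD_coordForm hφ hx
  obtain ⟨h1, h2⟩ := hnear.current_iff hw hF hcl
  simp only [vfieldInChart_self] at h1 h2
  rw [← g.val_nabla, hw0] at h1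
  rw [← g.val_nabla, ← g.val_nabla, ← g.val_nabla, hw0, ← hframe.val_currentVec hx F (l x),
    ← hframe.val_currentVec hx F (a x)] at h2
  have hFx : ∀ v w, F x ![v, w] = u x * kappa g φ l a x *
      (g.val x (a x) v * g.val x (l x) w - g.val x (a x) w * g.val x (l x) v) := fun _ _ => rfl
  have hn : g.val x (l x) (n x) = -1 := (hframe.isNullFrame hx).ln
  have hn' : g.val x (a x) (n x) = 0 := (hframe.isNullFrame hx).an
  constructor
  · intro hu0
    simpa [hu0, hκ] using h1
  · by_cases hu0 : u x = 0
    · simp [hFx, hu0]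
    have h3 : (∀ v, F x ![g.currentVec F x, v] = 0) ↔
        (g.val x (l x) (g.currentVec F x) = 0 ∧ g.val x (a x) (g.currentVec F x) = 0) := by
      constructor
      · intro h
        have e1 := h (n x)
        have e2 := h (a x)
        rw [hFx, hn, hn'] at e1
        rw [hFx, hframe.la x hx, hframe.aa x hx] at e2
        simp [hu0, hκ] at e1 e2
        exact ⟨e2, e1⟩
      · rintro ⟨e1, e2⟩ v
        rw [hFx, e1, e2]
        ring
    rw [h3, h2]
    simp [hu0, hκ, sub_eq_zero]

/-- `F_u` is smooth, closed and null for every function `u` on the leaf space, so only the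
force-free condition remains. -/
theorem isNullForceFreeOn_fieldForm_iff (hφ : φ ∈ IsManifold.maximalAtlas (𝓡 4) ∞ M)
    (hT : TangentToSlices 𝓕.tangent φ) (hframe : IsAdaptedFrame 𝓕 φ.source s l a n)
    {u : M → ℝ} (hu : IsLeafFunction φ u) :
    IsNullForceFreeOn g (fieldForm g φ l a u) φ.source ↔
      ∀ x ∈ φ.source, u x ≠ 0 → g.val x (g.nabla l x (l x)) (a x) = 0 ∧
        g.val x (g.nabla l x (s x)) (s x) = g.val x (g.nabla l x (a x)) (a x) := by
  have heq := fun x (hx : x ∈ φ.source) => fieldForm_eq_coordForm hφ hT hframe hx u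
  constructor
  · exact fun h x hx => (fieldForm_forceFree_iff hφ hT hframe hx hu).2.1 (h.forceFree x hx)
  · intro h
    refine ⟨fun x hx => ?_, fun x hx => ?_, fun x hx => ?_, fun x hx => ?_⟩
    · exact (contDiffAt_coordForm hφ hx (hu.contMDiffAt hx)).congr_of_eventuallyEq
        (formInChart_eventuallyEq heq hx)
    · refine Eq.trans ?_ (hu.extD_coordForm hφ hx)
      rw [extD, extD, (formInChart_eventuallyEq heq hx).extDeriv_eq]
    · exact (fieldForm_forceFree_iff hφ hT hframe hx hu).2.2 (h x hx)
    · rw [LorentzMetric.fieldSq, (formInChart_fieldForm g φ l a u x).self_of_nhds]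
      exact (hframe.isNullFrameNear φ.open_source hx).self.formSq_smul_wedge _

/-- Along an adapted frame, pregeodesy and equipartition are pointwise scalar equations: the
remaining component of the acceleration, along `s`, vanishes because `dx³ ∧ dx⁴` is closed. -/
theorem pregeodesic_and_equipartition_iff (hφ : φ ∈ IsManifold.maximalAtlas (𝓡 4) ∞ M)
    (hT : TangentToSlices 𝓕.tangent φ) (hframe : IsAdaptedFrame 𝓕 φ.source s l a n) :
    (IsPregeodesicOn g l φ.source ∧ HasEquipartitionOn g s l a φ.source) ↔
      ∀ x ∈ φ.source, g.val x (g.nabla l x (l x)) (a x) = 0 ∧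
        g.val x (g.nabla l x (s x)) (s x) = g.val x (g.nabla l x (a x)) (a x) := by
  constructor
  · rintro ⟨⟨f, hf⟩, heq⟩ x hx
    constructor
    · rw [hf x hx, map_smul, smul_apply, hframe.la x hx, smul_zero]
    · have := heq x hx
      rw [nullMeanCurvature] at this
      linarith
  · intro h
    refine ⟨⟨fun x => -g.val x (n x) (g.nabla l x (l x)), fun x hx => ?_⟩, fun x hx => ?_⟩
    · have hf := hframe.isNullFrame hx
      have h1 : g.val x (s x) (g.nabla l x (l x)) = 0 := by
        rw [g.symm]
        exact (fieldForm_forceFree_iff hφ hT hframe hx (isLeafFunction_const φ 1)).1 one_ne_zero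
      have h2 : g.val x (a x) (g.nabla l x (l x)) = 0 := by rw [g.symm]; exact (h x hx).1
      have h3 : g.val x (l x) (g.nabla l x (l x)) = 0 := by
        rw [g.symm]; exact hframe.val_nabla_self hx (l x)
      beta_reduce
      generalize g.nabla l x (l x) = Z at h1 h2 h3 ⊢
      have e : Z = g.val x (s x) Z • s x + g.val x (a x) Z • a x - g.val x (l x) Z • n x -
        g.val x (n x) Z • l x := hf.expand Z
      rw [h1, h2, h3] at e
      refine e.trans ?_
      module
    · rw [nullMeanCurvature, (h x hx).2]
      ring

end Spacetime

end

theorem mainTheorem3 {M : Type*} [TopologicalSpace M] [ChartedSpace E4 M]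
    [IsManifold (𝓡 4) ∞ M] (g : LorentzMetric M) (𝓕 : NullFoliation g)
    (p : M) (φ : OpenPartialHomeomorph M E4) (hφ : IsAdaptedChart 𝓕 p φ)
    (s l a n : VField M) (hframe : IsAdaptedFrame 𝓕 φ.source s l a n) :
    (IsUniqueSolutionClass 𝓕 φ l a ↔
      IsPregeodesicOn g l φ.source ∧ HasEquipartitionOn g s l a φ.source) ∧
    (∀ u : M → ℝ, IsLeafFunction φ u → (∀ x ∈ φ.source, u x ≠ 0) →
      ((IsNullForceFreeOn g (fieldForm g φ l a u) φ.source ∧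
          ∀ x ∈ φ.source, formKer (fieldForm g φ l a u) x = 𝓕.tangent x) ↔
        IsPregeodesicOn g l φ.source ∧ HasEquipartitionOn g s l a φ.source)) ∧
    (∀ s' : VField M, SmoothVFieldOn s' φ.source →
      (∀ x ∈ φ.source, s' x ∈ 𝓕.tangent x ∧ g.val x (s' x) (s' x) = 1) →
      (∀ x ∈ φ.source, g.val x (g.nabla l x (s' x)) (s' x) = g.val x (g.nabla l x (s x)) (s x)) ∧
      (HasEquipartitionOn g s' l a φ.source ↔ HasEquipartitionOn g s l a φ.source)) := by
  have hA := hφ.mem_atlas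
  have hT := hφ.tangent
  have hker : ∀ u : M → ℝ, ∀ x ∈ φ.source, u x ≠ 0 →
      formKer (fieldForm g φ l a u) x = 𝓕.tangent x := by
    intro u x hx hu
    have : formKer (fieldForm g φ l a u) x = formKer (coordForm φ u) x := by
      rw [formKer, formKer, fieldForm_eq_coordForm hA hT hframe hx]
    rw [this, formKer_coordForm hA hT hx hu]
  refine ⟨?_, fun u hu hu0 => ?_, fun s' _ hs' => ?_⟩
  · rw [pregeodesic_and_equipartition_iff hA hT hframe]
    constructor
    · intro h x hx
      exact (isNullForceFreeOn_fieldForm_iff hA hT hframe (isLeafFunction_const φ 1)).1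
        (h.solution _ (isLeafFunction_const φ 1)) x hx one_ne_zero
    · intro h
      refine ⟨fun u hu => ?_, fun u _ => hker u, fun F hF hFker => ?_⟩
      · exact (isNullForceFreeOn_fieldForm_iff hA hT hframe hu).2 fun x hx _ => h x hx
      · set u : M → ℝ := fun x => F x ![coordVec φ 2 x, coordVec φ 3 x]
        have hFu : ∀ x ∈ φ.source, F x = coordForm φ u x := fun x hx =>
          eq_coordForm_of_formKer hA hT hx (hFker x hx)
        have hsm : ∀ x ∈ φ.source, ContMDiffAt (𝓡 4) 𝓘(ℝ, ℝ) ∞ u x := fun x hx =>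
          contMDiffAt_of_contDiffAt_coordForm hA hx ((hF.smooth x hx).congr_of_eventuallyEq
            (formInChart_eventuallyEq hFu hx).symm)
        refine ⟨u, isLeafFunction_of_closed hA hφ.connected hsm fun x hx => ?_,
          fun x hx hux => ?_, fun x hx => ?_⟩
        · refine Eq.trans ?_ (hF.closed x hx)
          rw [extD, extD, (formInChart_eventuallyEq hFu hx).extDeriv_eq]
        · -- If `u` vanished, `F` would too, and `a` would be tangent to the leaves.
          have ha : a x ∈ formKer F x := by
            intro v
            rw [hFu x hx, coordForm_apply, hux, zero_mul]
          rw [hFker x hx] at ha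
          have := (hframe.flat_eq_zero hx ha).1
          rw [LorentzMetric.flat, hframe.aa x hx] at this
          exact one_ne_zero this
        · rw [hFu x hx, fieldForm_eq_coordForm hA hT hframe hx]
  · rw [pregeodesic_and_equipartition_iff hA hT hframe,
      isNullForceFreeOn_fieldForm_iff hA hT hframe hu]
    constructor
    · exact fun h x hx => h.1 x hx (hu0 x hx)
    · exact fun h => ⟨fun x hx _ => h x hx, fun x hx => hker u x hx (hu0 x hx)⟩
  · have key : ∀ x ∈ φ.source,
        g.val x (g.nabla l x (s' x)) (s' x) = g.val x (g.nabla l x (s x)) (s x) := by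
      intro x hx
      obtain ⟨hmem, hunit⟩ := hs' x hx
      rw [← hframe.span x hx, Submodule.mem_span_pair] at hmem
      -- `s' = c s + d l` with `c = ± 1`, and `g(∇ l, ·)` has no `s l`, `l s` or `l l` component.
      obtain ⟨c, d, hcd⟩ := hmem
      have hls := (fieldForm_forceFree_iff hA hT hframe hx (isLeafFunction_const φ 1)).1 one_ne_zero
      have hsl : g.val x (s x) (l x) = 0 := (hframe.isNullFrame hx).sl
      have hc : c * c = 1 := by
        rw [← hcd] at hunit
        simpa [hframe.ss x hx, hframe.ls x hx, hframe.ll x hx, hsl] using hunit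
      have h1 := hframe.val_nabla_self hx (s x)
      have h2 := hframe.val_nabla_self hx (l x)
      have hadd : g.nabla l x (s' x) = c • g.nabla l x (s x) + d • g.nabla l x (l x) := by
        rw [← hcd, g.nabla_combination]
      rw [hadd, ← hcd]
      simp only [map_add, map_smul, add_apply, smul_apply, smul_eq_mul, h1, h2, hls]
      linear_combination (g.val x (g.nabla l x (s x)) (s x)) * hc
    refine ⟨key, forall₂_congr fun x hx => ?_⟩
    rw [nullMeanCurvature, nullMeanCurvature, key x hx]
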